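/- Consider the Maker--Breaker domination game on a finite simple graph $G=(V,E)$: Dominator and Staller alternately claim unclaimed vertices; Dominator wins if at some point the vertices she has claimed form a dominating set of $G$, and otherwise Staller wins. The graph $G$ has outcome $\mathcal D$ if Dominator has a winning strategy whoever starts. An interval graph is the intersection graph of a finite family of nonempty closed intervals of the real line. A pairing dominating set of $G$ is a set of pairs $\{(u_1,v_1),\dots,(u_k,v_k)\}$ of vertices such that $u_1,v_1,\dots,u_k,v_k$ are pairwise distinct and $V=\bigcup_{i=1}^k N[u_i]\cap N[v_i]$, where $N[\cdot]$ denotes the closed neighborhood. Then the problem of deciding whether an interval graph has outcome $\mathcal D$ is in $\mathsf{NP}$: the language of (binary adjacency-matrix encodings of) interval graphs with outcome $\mathcal D$ has a verifier that runs in polynomial time on a Turing machine and uses certificates of polynomial length. Moreover, pairing dominating sets certify the yes-instances: an interval graph has outcome $\mathcal D$ if and only if it admits a pairing dominating set. -/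

import Mathlib

/-! ### The Maker-Breaker domination game -/

namespace MBDomination

/-- The closed neighborhood `N[v]`. -/
def closedNbhd {V : Type*} (G : SimpleGraph V) (v : V) : Set V :=
  {x | x = v ∨ G.Adj v x}

/-- `S` is a dominating set: every vertex `v` has some `x ∈ S ∩ N[v]`. -/
def IsDominating {V : Type*} (G : SimpleGraph V) (S : Set V) : Prop :=
  ∀ v, ∃ x ∈ S, x ∈ closedNbhd G v

inductive Player
  | dominator
  | staller

/-- `DominatorWins G p D S`: from the position in which Dominator has claimed `D`, Staller has
claimed `S`, and it is the turn of player `p`, Dominator has a winning strategy on the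
finite graph `G`. Dominator has won as soon as `D` is dominating; if all vertices are claimed and
`D` is not dominating, then no clause applies and Staller has won. -/
inductive DominatorWins {V : Type*} (G : SimpleGraph V) : Player → Set V → Set V → Prop
  | won (p : Player) (D S : Set V) (h : IsDominating G D) : DominatorWins G p D S
  | dominator_move (D S : Set V) (v : V) (hv : v ∉ D ∪ S)
      (h : DominatorWins G Player.staller (insert v D) S) :
      DominatorWins G Player.dominator D S
  | staller_move (D S : Set V) (hfree : ∃ v, v ∉ D ∪ S)
      (h : ∀ v, v ∉ D ∪ S → DominatorWins G Player.dominator D (insert v S)) :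
      DominatorWins G Player.staller D S

/-- The outcome of `G` is `𝒟`: Dominator wins whoever starts (no vertex being claimed at the
beginning). -/
def HasOutcomeD {V : Type*} (G : SimpleGraph V) : Prop :=
  ∀ p : Player, DominatorWins G p ∅ ∅

/-- The pairs `(u 0, v 0), …, (u (k-1), v (k-1))` form a pairing dominating set: all the
`2k` vertices are distinct and `V = ⋃ i, N[u i] ∩ N[v i]`. -/
def IsPairingDominatingSet {V : Type*} (G : SimpleGraph V) {k : ℕ} (u v : Fin k → V) : Prop :=
  Function.Injective (Sum.elim u v) ∧
    ⋃ i, closedNbhd G (u i) ∩ closedNbhd G (v i) = Set.univ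

/-- `G` is the intersection graph of a family of (nonempty, closed) intervals of the real line. -/
def IsIntervalGraph {V : Type*} (G : SimpleGraph V) : Prop :=
  ∃ l r : V → ℝ, (∀ v, l v ≤ r v) ∧
    ∀ v w, v ≠ w → (G.Adj v w ↔ (Set.Icc (l v) (r v) ∩ Set.Icc (l w) (r w)).Nonempty)

/-! ### The class NP -/

/-- The word `x # y`, where `none` is the separator `#`. -/
def pairCode (xy : List Bool × List Bool) : List (Option Bool) :=
  xy.1.map some ++ none :: xy.2.map some

/-- `L` is in NP: there are a polynomial `p` and a verifier `R`, computed by a Turing machine in time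
polynomial in the length of its input `x # y`, such that `x ∈ L` if and only if the verifier
accepts `(x, y)` for some certificate `y` of length at most `p(|x|)`. -/
def InNP (L : Language Bool) : Prop :=
  ∃ (p : Polynomial ℕ) (R : List Bool × List Bool → Bool),
    Nonempty (Turing.TM2ComputableInPolyTime pairCode Computability.encodeBool R) ∧
    ∀ x : List Bool, x ∈ L ↔ ∃ y : List Bool, y.length ≤ p.eval x.length ∧ R (x, y) = true

/-! ### The decision problem -/

open Classical in
/-- The binary encoding of a graph on `n` vertices: the number `n` in unary, a `0`, and then the
rows of the adjacency matrix. -/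
noncomputable def encodeGraph {n : ℕ} (G : SimpleGraph (Fin n)) : List Bool :=
  List.replicate n true ++ false ::
    (List.finRange n).flatMap fun i => (List.finRange n).map fun j => decide (G.Adj i j)

/-- The yes-instances of the problem: the interval graphs with outcome `𝒟`. -/
def outcomeDIntervalGraphs : Language Bool :=
  {x | ∃ (n : ℕ) (G : SimpleGraph (Fin n)),
    IsIntervalGraph G ∧ HasOutcomeD G ∧ x = encodeGraph G}

end MBDomination

/-! A pairing gives Dominator the usual reply strategy: whenever Staller takes a vertex, take its
partner. The substance is the converse on interval graphs. Consider a position with free vertices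
`F` and undominated vertices `U`, and suppose no matching inside `F` puts a pair into the closed
neighborhood of every vertex of `U`. The key lemma `exists_full_enlargement` says that some interval
`x ∈ F` can be stretched to the whole line without creating a pairing. Staller plays this `x`. If
Dominator answers `y` and the new position has a pairing, adding the pair `{x, y}` gives a pairing
of the stretched family: everything `y` dominates is met by both `y` and the full interval `x`. This
is a contradiction, so induction over the game yields a pairing from every position that Dominator
wins as second player.

The key lemma reduces to families that are maximal without a pairing (`exists_full_of_maximal`). If
such a family had no full interval, enlarging one of two suitably chosen intervals `p` and `v` would
give two pairings; the left part of one, the right part of the other and the new pair `{p, v}`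
combine into a pairing of the original family.

Membership in NP follows because a yes-instance is witnessed by an interval representation together
with a pairing. The certificate is a table with one word per vertex. The words carry a discretised
interval, a colour naming the vertex's pair, the colour of a pair inside its closed neighborhood,
and an identity. All conditions are local to two words or are counts along a row with small
thresholds, so a finite control run over all pairs of words checks them in quadratic time
(`machine_outputs`, `result_control_iff`). Soundness and completeness are `IsTable.isIntervalGraph`,
`IsTable.pairable` and `exists_table`. -/

namespace MBDomination

/-! ### Pairings in interval hypergraphs -/

/-- `R` is a partial matching of the elements of `F` such that each point of `U` belongs to both
elements of some matched pair. -/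
structure IsPairing {ι κ : Type*} (mem : ι → κ → Prop) (F : Set ι) (U : Set κ)
    (R : ι → ι → Prop) : Prop where
  symm : ∀ x y, R x y → R y x
  irrefl : ∀ x, ¬ R x x
  unique : ∀ x y z, R x y → R x z → y = z
  free : ∀ x y, R x y → x ∈ F
  cover : ∀ u ∈ U, ∃ x y, R x y ∧ mem x u ∧ mem y u

def Pairable {ι κ : Type*} (mem : ι → κ → Prop) (F : Set ι) (U : Set κ) : Prop :=
  ∃ R, IsPairing mem F U R

theorem IsPairing.congr_mem {ι κ : Type*} {mem mem' : ι → κ → Prop} {F : Set ι} {U : Set κ}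
    {R : ι → ι → Prop} (h : IsPairing mem F U R)
    (hm : ∀ u ∈ U, ∀ x y, R x y → mem x u → mem y u → mem' x u ∧ mem' y u) :
    Pairable mem' F U :=
  ⟨R, h.symm, h.irrefl, h.unique, h.free, fun u hu => by
    obtain ⟨x, y, hxy, hx, hy⟩ := h.cover u hu
    exact ⟨x, y, hxy, hm u hu x y hxy hx hy⟩⟩

theorem Pairable.mono {ι κ : Type*} {mem mem' : ι → κ → Prop} {F : Set ι} {U : Set κ}
    (h : Pairable mem F U) (hm : ∀ x ∈ F, ∀ u ∈ U, mem x u → mem' x u) : Pairable mem' F U := by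
  obtain ⟨R, h⟩ := h
  exact h.congr_mem fun u hu x y hxy hx hy =>
    ⟨hm x (h.free _ _ hxy) u hu hx, hm y (h.free _ _ (h.symm _ _ hxy)) u hu hy⟩

/-- The interval `[lo x, hi x]` meets the interval `[A u, B u]`. -/
def Meets {ι κ : Type*} (A B : κ → ℕ) (lo hi : ι → ℕ) (x : ι) (u : κ) : Prop :=
  lo x ≤ B u ∧ A u ≤ hi x

/-- Only `p` has changed, so a pairing that exists after but not before the change must somewhere
rely on the new part of `p`; this can only happen through the pair containing `p`. -/
theorem IsPairing.exists_partner_of_enlarge {ι κ : Type*} [DecidableEq ι]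
    {A B : κ → ℕ} {lo hi lo' hi' : ι → ℕ}
    {F : Set ι} {U : Set κ} {R : ι → ι → Prop} {p : ι}
    (h : IsPairing (Meets A B lo' hi') F U R)
    (hlo : ∀ x, x ≠ p → lo' x = lo x) (hhi : ∀ x, x ≠ p → hi' x = hi x)
    (hn : ¬ Pairable (Meets A B lo hi) F U) :
    ∃ s, R p s ∧ s ≠ p ∧ ∃ u ∈ U, Meets A B lo' hi' p u ∧ Meets A B lo hi s u ∧
      ¬ Meets A B lo hi p u := by
  by_contra hcon
  push Not at hcon
  have key : ∀ s, R p s → ∀ u ∈ U, Meets A B lo' hi' p u → Meets A B lo' hi' s u →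
      Meets A B lo hi p u ∧ Meets A B lo hi s u := by
    intro s hs u hu h1 h2
    have hsp : s ≠ p := fun e => h.irrefl p (e ▸ hs)
    have h3 : Meets A B lo hi s u := by
      unfold Meets at h2 ⊢
      rwa [hlo s hsp, hhi s hsp] at h2
    exact ⟨hcon s hs hsp u hu h1 h3, h3⟩
  refine hn (h.congr_mem fun u hu x y hxy hx hy => ?_)
  by_cases hxp : x = p
  · subst hxp
    exact key y hxy u hu hx hy
  by_cases hyp : y = p
  · subst hyp
    exact (key x (h.symm _ _ hxy) u hu hy hx).symm
  unfold Meets at hx hy ⊢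
  rw [hlo x hxp, hhi x hxp] at hx
  rw [hlo y hyp, hhi y hyp] at hy
  exact ⟨hx, hy⟩

/-- In a family of intervals that admits no pairing and that is maximal with this property, some
interval is full. -/
theorem exists_full_of_maximal {ι κ : Type*} [Finite ι] [DecidableEq ι] {A B : κ → ℕ} {q : ℕ}
    {lo hi : ι → ℕ} {F : Set ι} {U : Set κ} (hF : F.Nonempty)
    (hn : ¬ Pairable (Meets A B lo hi) F U)
    (hlo : ∀ x ∈ F, 0 < lo x → Pairable (Meets A B (Function.update lo x 0) hi) F U)
    (hhi : ∀ x ∈ F, ∀ t, hi x < q → hi x < t →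
      Pairable (Meets A B lo (Function.update hi x t)) F U) :
    ∃ x ∈ F, lo x = 0 ∧ q ≤ hi x := by
  have hup : ∀ (f : ι → ℕ) (p : ι) (t : ℕ) (x : ι), x ≠ p → Function.update f p t x = f x :=
    fun f p t x hx => Function.update_of_ne hx _ _
  -- Stretching the leftmost interval further left gains nothing: a point that the partner also
  -- meets lies far enough right to satisfy the old left bound already.
  have h0 : ∃ x ∈ F, lo x = 0 := by
    obtain ⟨x, hx, hmin⟩ := Set.exists_min_image F lo F.toFinite hF
    refine ⟨x, hx, ?_⟩
    by_contra hpos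
    obtain ⟨R, hR⟩ := hlo x hx (Nat.pos_of_ne_zero hpos)
    obtain ⟨s, hs, -, u, -, h1, h2, h3⟩ :=
      hR.exists_partner_of_enlarge (hup lo x 0) (fun _ _ => rfl) hn
    exact h3 ⟨(hmin s (hR.free _ _ (hR.symm _ _ hs))).trans h2.1, h1.2⟩
  obtain ⟨p, ⟨hpF, hp0⟩, hpmax⟩ := Set.exists_max_image {x | x ∈ F ∧ lo x = 0} hi
    (Set.toFinite _) h0
  by_cases hpq : q ≤ hi p
  · exact ⟨p, hpF, hp0, hpq⟩
  exfalso
  push Not at hpq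
  have h1 : ∃ v ∈ F, hi p < hi v := by
    by_contra hcon
    push Not at hcon
    obtain ⟨R, hR⟩ := hhi p hpF q hpq hpq
    obtain ⟨s, hs, -, u, -, h1, h2, h3⟩ :=
      hR.exists_partner_of_enlarge (fun _ _ => rfl) (hup hi p q) hn
    exact h3 ⟨h1.1, h2.2.trans (hcon s (hR.free _ _ (hR.symm _ _ hs)))⟩
  -- `p` reaches furthest right among the intervals starting at `0`, and `v` starts first among
  -- those that outreach `p`. Hence anything starting before `v` ends no later than `p` (`hcross`).
  obtain ⟨v, ⟨hvF, hvhi⟩, hvmin⟩ := Set.exists_min_image {x | x ∈ F ∧ hi p < hi x} lo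
    (Set.toFinite _) h1
  have hv0 : 0 < lo v := by
    rcases Nat.eq_zero_or_pos (lo v) with h | h
    · exact absurd (hpmax v ⟨hvF, h⟩) (not_le.2 hvhi)
    · exact h
  have hcross : ∀ x ∈ F, lo x < lo v → hi x ≤ hi p := fun x hx hlt => by
    by_contra hgt
    exact absurd (hvmin x ⟨hx, not_le.1 hgt⟩) (not_le.2 hlt)
  -- Maximality gives a pairing `R₁` after stretching `p` right to the end of `v`, and a pairing
  -- `R₂` after stretching `v` left to `0`. Since the stretched parts are really used, the partner
  -- of `p` in `R₁` starts no earlier than `v`, and the partner of `v` in `R₂` ends no later than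
  -- `p`.
  obtain ⟨R₁, hR₁⟩ := hhi p hpF (hi v) hpq hvhi
  obtain ⟨R₂, hR₂⟩ := hlo v hvF hv0
  obtain ⟨s₁, hs₁, -, u₁, -, h11, h12, h13⟩ :=
    hR₁.exists_partner_of_enlarge (fun _ _ => rfl) (hup hi p (hi v)) hn
  obtain ⟨s₂, hs₂, -, u₂, -, h21, h22, h23⟩ :=
    hR₂.exists_partner_of_enlarge (hup lo v 0) (fun _ _ => rfl) hn
  have hs₁lo : lo v ≤ lo s₁ := by
    by_contra hlt
    exact h13 ⟨h11.1, h12.2.trans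
      (hcross s₁ (hR₁.free _ _ (hR₁.symm _ _ hs₁)) (not_le.1 hlt))⟩
  have hs₂hi : hi s₂ ≤ hi p := by
    by_contra hlt
    exact h23 ⟨(hvmin s₂ ⟨hR₂.free _ _ (hR₂.symm _ _ hs₂), not_le.1 hlt⟩).trans h22.1, h21.2⟩
  have hpv : p ≠ v := fun e => by subst e; omega
  -- The two partner bounds keep `p` out of `L` and `v` out of `Q`, so these pairs use only
  -- unmodified intervals and leave `p` and `v` free to be matched together.
  let L : ι → ι → Prop := fun x y => R₁ x y ∧ lo x < lo v ∧ lo y < lo v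
  let Q : ι → ι → Prop := fun x y => R₂ x y ∧ hi p < hi x ∧ hi p < hi y
  have hLp : ∀ y, ¬ L p y := fun y h => by
    have := hR₁.unique _ _ _ h.1 hs₁
    subst this
    exact absurd h.2.2 (not_lt.2 hs₁lo)
  have hLv : ∀ y, ¬ L v y := fun y h => lt_irrefl _ h.2.1
  have hQp : ∀ y, ¬ Q p y := fun y h => lt_irrefl _ h.2.1
  have hQv : ∀ y, ¬ Q v y := fun y h => by
    have := hR₂.unique _ _ _ h.1 hs₂
    subst this
    exact absurd h.2.2 (not_lt.2 hs₂hi)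
  have hLsymm : ∀ x y, L x y → L y x := fun x y h => ⟨hR₁.symm _ _ h.1, h.2.2, h.2.1⟩
  have hQsymm : ∀ x y, Q x y → Q y x := fun x y h => ⟨hR₂.symm _ _ h.1, h.2.2, h.2.1⟩
  have hLQ : ∀ x y z, L x y → Q x z → False := fun x y z h h' =>
    absurd (hcross x (hR₁.free _ _ h.1) h.2.1) (not_le.2 h'.2.1)
  refine hn ⟨fun x y => (x = p ∧ y = v) ∨ (x = v ∧ y = p) ∨ L x y ∨ Q x y, ?_, ?_, ?_, ?_, ?_⟩
  · rintro x y (⟨rfl, rfl⟩ | ⟨rfl, rfl⟩ | h | h)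
    · exact Or.inr (Or.inl ⟨rfl, rfl⟩)
    · exact Or.inl ⟨rfl, rfl⟩
    · exact Or.inr (Or.inr (Or.inl (hLsymm _ _ h)))
    · exact Or.inr (Or.inr (Or.inr (hQsymm _ _ h)))
  · rintro x (⟨rfl, h⟩ | ⟨rfl, h⟩ | h | h)
    · exact hpv h
    · exact hpv h.symm
    · exact hR₁.irrefl _ h.1
    · exact hR₂.irrefl _ h.1
  · rintro x y z (⟨rfl, rfl⟩ | ⟨rfl, rfl⟩ | h | h) (⟨e, rfl⟩ | ⟨e, rfl⟩ | h' | h')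
    · rfl
    · exact absurd e hpv
    · exact absurd h' (hLp _)
    · exact absurd h' (hQp _)
    · exact absurd e.symm hpv
    · rfl
    · exact absurd h' (hLv _)
    · exact absurd h' (hQv _)
    · exact absurd (e ▸ h) (hLp _)
    · exact absurd (e ▸ h) (hLv _)
    · exact hR₁.unique _ _ _ h.1 h'.1
    · exact (hLQ _ _ _ h h').elim
    · exact absurd (e ▸ h) (hQp _)
    · exact absurd (e ▸ h) (hQv _)
    · exact (hLQ _ _ _ h' h).elim
    · exact hR₂.unique _ _ _ h.1 h'.1
  · rintro x y (⟨rfl, rfl⟩ | ⟨rfl, rfl⟩ | h | h)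
    · exact hpF
    · exact hvF
    · exact hR₁.free _ _ h.1
    · exact hR₂.free _ _ h.1
  -- Points lying before `v` are covered by `L`, points lying after `p` by `Q`, and all remaining
  -- points meet both `p` and `v`.
  · intro u hu
    by_cases hB : B u < lo v
    · obtain ⟨x, y, hxy, hx, hy⟩ := hR₁.cover u hu
      have hL : L x y := ⟨hxy, hx.1.trans_lt hB, hy.1.trans_lt hB⟩
      have hxp : x ≠ p := fun e => hLp _ (e ▸ hL)
      have hyp : y ≠ p := fun e => hLp _ (e ▸ hLsymm _ _ hL)
      refine ⟨x, y, Or.inr (Or.inr (Or.inl hL)), ⟨hx.1, ?_⟩, ⟨hy.1, ?_⟩⟩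
      · exact (hup hi p (hi v) x hxp) ▸ hx.2
      · exact (hup hi p (hi v) y hyp) ▸ hy.2
    by_cases hAu : hi p < A u
    · obtain ⟨x, y, hxy, hx, hy⟩ := hR₂.cover u hu
      have hQ : Q x y := ⟨hxy, hAu.trans_le hx.2, hAu.trans_le hy.2⟩
      have hxp : x ≠ v := fun e => hQv _ (e ▸ hQ)
      have hyp : y ≠ v := fun e => hQv _ (e ▸ hQsymm _ _ hQ)
      refine ⟨x, y, Or.inr (Or.inr (Or.inr hQ)), ⟨?_, hx.2⟩, ⟨?_, hy.2⟩⟩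
      · exact (hup lo v 0 x hxp) ▸ hx.1
      · exact (hup lo v 0 y hyp) ▸ hy.1
    · refine ⟨p, v, Or.inl ⟨rfl, rfl⟩, ⟨?_, not_lt.1 hAu⟩, ⟨not_lt.1 hB, ?_⟩⟩
      · rw [hp0]; exact Nat.zero_le _
      · exact (not_lt.1 hAu).trans hvhi.le

/-- In a family of intervals that admits no pairing, some interval can be replaced by the full
interval without creating a pairing. -/
theorem exists_full_enlargement {ι κ : Type*} [Finite ι] [DecidableEq ι] {A B : κ → ℕ} {q : ℕ}
    (hA : ∀ u, A u ≤ q) {F : Set ι} (hF : F.Nonempty) {U : Set κ} (lo hi : ι → ℕ)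
    (hn : ¬ Pairable (Meets A B lo hi) F U) :
    ∃ x ∈ F, ¬ Pairable (Meets A B (Function.update lo x 0) (Function.update hi x q)) F U := by
  have := Fintype.ofFinite ι
  -- The sum measures how far the family is from consisting of full intervals; every enlargement
  -- allowed in the maximality hypotheses decreases it.
  induction hN : ∑ x, (lo x + (q - hi x)) using Nat.strong_induction_on generalizing lo hi with
  | _ N ih =>
  by_cases hlo : ∀ x ∈ F, 0 < lo x → Pairable (Meets A B (Function.update lo x 0) hi) F U
  · by_cases hhi : ∀ x ∈ F, ∀ t, hi x < q → hi x < t →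
        Pairable (Meets A B lo (Function.update hi x t)) F U
    · obtain ⟨x, hx, h0, hq⟩ := exists_full_of_maximal hF hn hlo hhi
      refine ⟨x, hx, fun h => hn (h.mono fun y _ u _ hy => ?_)⟩
      by_cases hyx : y = x
      · subst hyx
        exact ⟨h0 ▸ Nat.zero_le _, (hA u).trans hq⟩
      · simpa [Meets, hyx] using hy
    · push Not at hhi
      obtain ⟨x, hx, t, hxq, hxt, hnx⟩ := hhi
      obtain ⟨y, hy, hny⟩ := ih _ (by
        rw [← hN]
        refine Finset.sum_lt_sum (fun y _ => ?_) ⟨x, Finset.mem_univ _, ?_⟩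
        · by_cases hyx : y = x
          · subst hyx; simp only [Function.update_self]; omega
          · simp [hyx]
        · simp only [Function.update_self]; omega) lo _ hnx rfl
      refine ⟨y, hy, fun h => hny (h.mono fun z _ u _ hz => ?_)⟩
      by_cases hzy : z = y
      · subst hzy; simpa [Meets] using hz
      · refine ⟨hz.1, hz.2.trans ?_⟩
        simp only [Function.update_of_ne hzy]
        by_cases hzx : z = x
        · subst hzx; simp [hxt.le]
        · simp [hzx]
  · push Not at hlo
    obtain ⟨x, hx, hx0, hnx⟩ := hlo
    obtain ⟨y, hy, hny⟩ := ih _ (by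
      rw [← hN]
      refine Finset.sum_lt_sum (fun y _ => ?_) ⟨x, Finset.mem_univ _, ?_⟩
      · by_cases hyx : y = x
        · subst hyx; simp
        · simp [hyx]
      · simp only [Function.update_self]; omega) _ hi hnx rfl
    refine ⟨y, hy, fun h => hny (h.mono fun z _ u _ hz => ?_)⟩
    by_cases hzy : z = y
    · subst hzy; simpa [Meets] using hz
    · refine ⟨le_trans ?_ hz.1, hz.2⟩
      simp only [Function.update_of_ne hzy]
      by_cases hzx : z = x
      · subst hzx; simp
      · simp [hzx]

/-! ### The game on interval graphs -/

/-- A pairing after the exchange of `x` and `y` gives a pairing in which `x` is full. -/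
theorem Pairable.of_exchange {ι κ : Type*} {mem mem' : ι → κ → Prop} {F : Set ι}
    {U : Set κ} {x y : ι} (hx : x ∈ F) (hy : y ∈ F) (hxy : x ≠ y)
    (hfull : ∀ u, mem' x u) (hmem : ∀ z u, mem z u → mem' z u)
    (h : Pairable mem (F \ {x, y}) {u ∈ U | ¬ mem y u}) : Pairable mem' F U := by
  obtain ⟨R, hR⟩ := h
  have hRx : ∀ z, ¬ R x z := fun z h => (hR.free _ _ h).2 (by simp)
  have hRy : ∀ z, ¬ R y z := fun z h => (hR.free _ _ h).2 (by simp)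
  refine ⟨fun a b => (a = x ∧ b = y) ∨ (a = y ∧ b = x) ∨ R a b, ?_, ?_, ?_, ?_, ?_⟩
  · rintro a b (⟨rfl, rfl⟩ | ⟨rfl, rfl⟩ | h)
    · exact Or.inr (Or.inl ⟨rfl, rfl⟩)
    · exact Or.inl ⟨rfl, rfl⟩
    · exact Or.inr (Or.inr (hR.symm _ _ h))
  · rintro a (⟨rfl, h⟩ | ⟨rfl, h⟩ | h)
    · exact hxy h
    · exact hxy h.symm
    · exact hR.irrefl _ h
  · rintro a b c (⟨rfl, rfl⟩ | ⟨rfl, rfl⟩ | h) (⟨h1, rfl⟩ | ⟨h1, rfl⟩ | h')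
    · rfl
    · exact absurd h1 hxy
    · exact absurd h' (hRx _)
    · exact absurd h1.symm hxy
    · rfl
    · exact absurd h' (hRy _)
    · exact absurd (h1 ▸ h) (hRx _)
    · exact absurd (h1 ▸ h) (hRy _)
    · exact hR.unique _ _ _ h h'
  · rintro a b (⟨rfl, rfl⟩ | ⟨rfl, rfl⟩ | h)
    · exact hx
    · exact hy
    · exact (hR.free _ _ h).1
  -- Points met by `y` are covered by the new pair, because `x` is full; all others are covered by
  -- the old pairing.
  · intro u hu
    by_cases hyu : mem y u
    · exact ⟨x, y, Or.inl ⟨rfl, rfl⟩, hfull u, hmem _ _ hyu⟩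
    · obtain ⟨a, b, hab, ha, hb⟩ := hR.cover u ⟨hu, hyu⟩
      exact ⟨a, b, Or.inr (Or.inr hab), hmem _ _ ha, hmem _ _ hb⟩

/-- Real endpoints are replaced by ranks. The two inequalities in `Meets` use separate scales: `lo`
and `B` count right ends strictly below a point, `hi` and `A` count left ends at or below it. Each
scale preserves `≤` in its own comparison because one side there is an endpoint of the counted kind.
Nothing requires `A u ≤ B u` or `lo x ≤ hi x`. -/
theorem IsIntervalGraph.exists_meets {V : Type*} [Finite V] {G : SimpleGraph V}
    (hG : IsIntervalGraph G) : ∃ (A B lo hi : V → ℕ) (q : ℕ), (∀ u, A u ≤ q) ∧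
      ∀ x u, x ∈ closedNbhd G u ↔ Meets A B lo hi x u := by
  classical
  have := Fintype.ofFinite V
  obtain ⟨l, r, hlr, hadj⟩ := hG
  have hmem : ∀ x u, x ∈ closedNbhd G u ↔ l x ≤ r u ∧ l u ≤ r x := by
    intro x u
    by_cases hxu : x = u
    · subst hxu
      simp [closedNbhd, hlr]
    · rw [closedNbhd, Set.mem_ofPred_eq, hadj u x (Ne.symm hxu), Set.Icc_inter_Icc,
        Set.nonempty_Icc, sup_le_iff, le_inf_iff, le_inf_iff]
      simp [hxu, hlr, and_comm]
  have key1 : ∀ a b : ℝ, (∃ u, r u = b) → (a ≤ b ↔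
      (Finset.univ.filter fun u => r u < a).card ≤ (Finset.univ.filter fun u => r u < b).card) := by
    rintro a b ⟨u, rfl⟩
    refine ⟨fun h => Finset.card_le_card fun w => ?_, fun h => ?_⟩
    · simpa using fun hw => lt_of_lt_of_le hw h
    · by_contra hlt
      push Not at hlt
      refine absurd h (not_le.2 (Finset.card_lt_card (Finset.ssubset_iff_of_subset ?_ |>.2 ?_)))
      · exact fun w => by simpa using fun hw => lt_trans hw hlt
      · exact ⟨u, by simpa using hlt, by simp⟩
  have key2 : ∀ a b : ℝ, (∃ u, l u = a) → (a ≤ b ↔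
      (Finset.univ.filter fun u => l u ≤ a).card ≤ (Finset.univ.filter fun u => l u ≤ b).card) := by
    rintro a b ⟨u, rfl⟩
    refine ⟨fun h => Finset.card_le_card fun w => ?_, fun h => ?_⟩
    · simpa using fun hw => le_trans hw h
    · by_contra hlt
      push Not at hlt
      refine absurd h (not_le.2 (Finset.card_lt_card (Finset.ssubset_iff_of_subset ?_ |>.2 ?_)))
      · exact fun w => by simpa using fun hw => hw.trans hlt.le
      · exact ⟨u, by simp, by simpa using hlt⟩
  refine ⟨fun u => (Finset.univ.filter fun w => l w ≤ l u).card,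
    fun u => (Finset.univ.filter fun w => r w < r u).card,
    fun x => (Finset.univ.filter fun w => r w < l x).card,
    fun x => (Finset.univ.filter fun w => l w ≤ r x).card, Fintype.card V,
    fun u => Finset.card_le_univ _, fun x u => ?_⟩
  rw [hmem, key1 _ _ ⟨u, rfl⟩, key2 _ _ ⟨u, rfl⟩, Meets]

theorem isDominating_iff {V : Type*} (G : SimpleGraph V) (D : Set V) :
    IsDominating G D ↔ {u | ∀ x ∈ D, x ∉ closedNbhd G u} = ∅ := by
  simp [IsDominating, Set.eq_empty_iff_forall_notMem]

/-- If Dominator wins as second player, then the free vertices have a pairing that covers the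
undominated vertices. -/
theorem pairable_of_dominatorWins {V : Type*} [Finite V] {G : SimpleGraph V}
    (hG : IsIntervalGraph G) {p : Player} {D S : Set V} (h : DominatorWins G p D S) :
    p = Player.staller → Pairable (fun x u => x ∈ closedNbhd G u) (D ∪ S)ᶜ
      {u | ∀ x ∈ D, x ∉ closedNbhd G u} := by
  classical
  obtain ⟨A, B, lo, hi, q, hA, hmem⟩ := hG.exists_meets
  -- The induction also needs a statement for Dominator's turn: she has already won, or some move
  -- leads to a position with a pairing.
  suffices hs : (p = Player.staller → Pairable (fun x u => x ∈ closedNbhd G u) (D ∪ S)ᶜ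
      {u | ∀ x ∈ D, x ∉ closedNbhd G u}) ∧ (p = Player.dominator →
      {u | ∀ x ∈ D, x ∉ closedNbhd G u} = ∅ ∨ ∃ y ∉ D ∪ S,
        Pairable (fun x u => x ∈ closedNbhd G u) (insert y D ∪ S)ᶜ
          {u | ∀ x ∈ insert y D, x ∉ closedNbhd G u}) from hs.1
  induction h with
  | won p D S h =>
    rw [isDominating_iff] at h
    rw [h]
    exact ⟨fun _ => ⟨fun _ _ => False, by simp, by simp, by simp, by simp, by simp⟩,
      fun _ => Or.inl rfl⟩
  | dominator_move D S v hv h ih =>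
    exact ⟨by simp, fun _ => Or.inr ⟨v, hv, ih.1 rfl⟩⟩
  | staller_move D S hfree h ih =>
    refine ⟨fun _ => ?_, by simp⟩
    by_contra hn
    have hM : (fun x u => x ∈ closedNbhd G u) = Meets A B lo hi := by
      funext x u
      exact propext (hmem x u)
    -- Staller's refutation: take a vertex that could be made full without producing a pairing. Any
    -- good answer `y` would produce one by the exchange.
    obtain ⟨x, hx, hnx⟩ := exists_full_enlargement hA hfree lo hi (hM ▸ hn)
    rcases (ih x hx).2 rfl with h0 | ⟨y, hy, hP⟩
    · refine hn ?_
      rw [h0]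
      exact ⟨fun _ _ => False, by simp, by simp, by simp, by simp, by simp⟩
    · have hxy : x ≠ y := fun e => hy (by simp [e])
      refine hnx (Pairable.of_exchange (mem := Meets A B lo hi) hx
        (fun h' => hy (by rcases h' with h' | h' <;> simp [h'])) hxy
        (fun u => by simp [Meets, hA]) (fun z u hz => ?_) ?_)
      · by_cases hzx : z = x
        · subst hzx; simp [Meets, hA]
        · simpa [Meets, hzx] using hz
      · convert hP using 1
        · exact hM.symm
        · ext z
          change (¬ (z ∈ D ∨ z ∈ S) ∧ ¬ (z = x ∨ z = y)) ↔ ¬ ((z = y ∨ z ∈ D) ∨ z = x ∨ z ∈ S)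
          tauto
        · ext u
          simp only [Set.mem_ofPred_eq, Set.forall_mem_insert, ← hmem]
          tauto

/-! ### Pairing strategies -/

section PairingStrategy

variable {V : Type*} {G : SimpleGraph V} {R : V → V → Prop}

theorem IsPairing.isDominating
    (hR : IsPairing (fun x u => x ∈ closedNbhd G u) Set.univ Set.univ R) {D S : Set V}
    (hinv : ∀ x y, R x y → x ∈ S → y ∈ D) (hfull : ∀ v, v ∈ D ∪ S) : IsDominating G D := by
  intro u
  obtain ⟨x, y, hxy, hx, hy⟩ := hR.cover u trivial
  rcases hfull x with h | h
  · exact ⟨x, h, hx⟩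
  · exact ⟨y, hinv _ _ hxy h, hy⟩

/-- The invariant is that partners of Staller's vertices belong to Dominator. Extra Dominator
vertices never break it, so she may move arbitrarily when she starts or when the partner is absent
or already hers. -/
theorem IsPairing.dominatorWins [Finite V]
    (hR : IsPairing (fun x u => x ∈ closedNbhd G u) Set.univ Set.univ R) (p : Player)
    {D S : Set V} (hinv : ∀ x y, R x y → x ∈ S → y ∈ D) : DominatorWins G p D S := by
  classical
  induction hN : (D ∪ S)ᶜ.ncard using Nat.strong_induction_on generalizing p D S with
  | _ N ih =>
  subst hN
  have hlt : ∀ {D' S' : Set V} {v : V}, v ∉ D ∪ S → D ∪ S ⊆ D' ∪ S' → v ∈ D' ∪ S' →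
      (D' ∪ S')ᶜ.ncard < (D ∪ S)ᶜ.ncard := fun {D' S' v} hv hsub hv' =>
    Set.ncard_lt_ncard ⟨Set.compl_subset_compl.2 hsub, fun h => h hv hv'⟩
  have hdom : ∀ {D' S' : Set V}, (∀ x y, R x y → x ∈ S' → y ∈ D') → D ∪ S ⊆ D' ∪ S' →
      DominatorWins G Player.dominator D' S' := by
    intro D' S' hinv' hsub
    by_cases hfree : ∃ v, v ∉ D' ∪ S'
    · obtain ⟨v, hv⟩ := hfree
      refine .dominator_move _ _ v hv (ih _ ?_ _ (fun x y hxy hx => Or.inr (hinv' x y hxy hx)) rfl)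
      refine hlt (fun h => hv (hsub h)) (hsub.trans ?_) (by simp : v ∈ insert v D' ∪ S')
      exact Set.union_subset_union_left _ (Set.subset_insert _ _)
    · push Not at hfree
      exact .won _ _ _ (hR.isDominating hinv' hfree)
  cases p with
  | dominator => exact hdom hinv subset_rfl
  | staller =>
    by_cases hfree : ∃ v, v ∉ D ∪ S
    · refine .staller_move _ _ hfree fun x hx => ?_
      have hsub : D ∪ S ⊆ D ∪ insert x S := Set.union_subset_union_right _ (Set.subset_insert _ _)
      by_cases hy : ∃ y, R x y ∧ y ∉ D
      · obtain ⟨y, hxy, hy⟩ := hy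
        have hyS : y ∉ S := fun h => hx (Or.inl (hinv _ _ (hR.symm _ _ hxy) h))
        have hyx : y ≠ x := fun e => hR.irrefl x (e ▸ hxy)
        refine .dominator_move _ _ y (by simp [hy, hyS, hyx]) (ih _ ?_ _ ?_ rfl)
        · exact hlt hx (hsub.trans (Set.union_subset_union_left _ (Set.subset_insert _ _)))
            (by simp)
        · rintro a b hab (rfl | ha)
          · exact Or.inl (hR.unique _ _ _ hab hxy)
          · exact Or.inr (hinv _ _ hab ha)
      · push Not at hy
        refine hdom ?_ hsub
        rintro a b hab (rfl | ha)
        · exact hy _ hab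
        · exact hinv _ _ hab ha
    · push Not at hfree
      exact .won _ _ _ (hR.isDominating hinv hfree)

end PairingStrategy

theorem IsIntervalGraph.hasOutcomeD_iff_pairable {V : Type*} [Finite V] {G : SimpleGraph V}
    (hG : IsIntervalGraph G) :
    HasOutcomeD G ↔ Pairable (fun x u => x ∈ closedNbhd G u) Set.univ Set.univ := by
  refine ⟨fun h => ?_, fun ⟨R, hR⟩ p => hR.dominatorWins p (by simp)⟩
  simpa using pairable_of_dominatorWins hG (h Player.staller) rfl

theorem pairable_iff_exists_isPairingDominatingSet {V : Type*} [Finite V] (G : SimpleGraph V) :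
    Pairable (fun x u => x ∈ closedNbhd G u) Set.univ Set.univ ↔
      ∃ (k : ℕ) (u v : Fin k → V), IsPairingDominatingSet G u v := by
  constructor
  · rintro ⟨R, hR⟩
    obtain ⟨n, ⟨e⟩⟩ := Finite.exists_equiv_fin V
    -- The numbering `e` selects one representative of each unordered pair, namely its smaller
    -- element.
    let E := {a : V // ∃ b, R a b ∧ e a < e b}
    obtain ⟨k, ⟨f⟩⟩ := Finite.exists_equiv_fin E
    have hpart : ∀ a : E, ∃ b, R a b ∧ e a < e b := fun a => a.2
    choose g hg hlt using hpart
    have hgg : ∀ a b : E, g a = g b → a = b := fun a b h =>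
      Subtype.ext (hR.unique (g a) _ _ (hR.symm _ _ (hg a)) (h ▸ hR.symm _ _ (hg b)))
    refine ⟨k, fun i => (f.symm i).1, fun i => g (f.symm i), ?_, ?_⟩
    · have hne : ∀ a b : E, a.1 ≠ g b := fun a b h => by
        have h1 : R a.1 b.1 := h ▸ hR.symm _ _ (hg b)
        have h2 := hR.unique _ _ _ (hg a) h1
        have h3 := hlt a
        have h4 := hlt b
        rw [h2] at h3
        rw [← h] at h4
        exact lt_asymm h3 h4
      rintro (i | i) (j | j) h
      · simp only [Sum.elim_inl] at h
        exact congrArg Sum.inl (f.symm.injective (Subtype.ext h))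
      · exact absurd h (hne _ _)
      · exact absurd h.symm (hne _ _)
      · exact congrArg Sum.inr (f.symm.injective (hgg _ _ h))
    · refine Set.eq_univ_of_forall fun u => Set.mem_iUnion.2 ?_
      have hmem : ∀ x w, x ∈ closedNbhd G w ↔ w ∈ closedNbhd G x := fun x w => by
        simp only [closedNbhd, Set.mem_ofPred_eq, eq_comm (a := x), G.adj_comm w x]
      have key : ∀ x y, R x y → x ∈ closedNbhd G u → y ∈ closedNbhd G u → e x < e y →
          ∃ i, u ∈ closedNbhd G (f.symm i).1 ∩ closedNbhd G (g (f.symm i)) := by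
        intro x y hxy hx hy hlt
        refine ⟨f ⟨x, y, hxy, hlt⟩, ?_⟩
        rw [Equiv.symm_apply_apply]
        refine ⟨(hmem _ _).1 hx, ?_⟩
        rw [hR.unique _ _ _ (hg ⟨x, y, hxy, hlt⟩) hxy]
        exact (hmem _ _).1 hy
      obtain ⟨x, y, hxy, hx, hy⟩ := hR.cover u trivial
      rcases lt_trichotomy (e x) (e y) with h | h | h
      · exact key x y hxy hx hy h
      · exact absurd (e.injective h ▸ hxy) (hR.irrefl _)
      · exact key y x (hR.symm _ _ hxy) hy hx h
  · rintro ⟨k, u, v, hinj, hcov⟩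
    have hu : ∀ i j, u i = u j → i = j := fun i j h =>
      Sum.inl_injective (hinj (a₁ := Sum.inl i) (a₂ := Sum.inl j) h)
    have hv : ∀ i j, v i = v j → i = j := fun i j h =>
      Sum.inr_injective (hinj (a₁ := Sum.inr i) (a₂ := Sum.inr j) h)
    have huv : ∀ i j, u i ≠ v j := fun i j h =>
      Sum.inl_ne_inr (hinj (a₁ := Sum.inl i) (a₂ := Sum.inr j) h)
    refine ⟨fun x y => ∃ i, (x = u i ∧ y = v i) ∨ (x = v i ∧ y = u i), ?_, ?_, ?_, by simp, ?_⟩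
    · rintro x y ⟨i, h⟩
      exact ⟨i, by tauto⟩
    · rintro x ⟨i, ⟨h1, h2⟩ | ⟨h1, h2⟩⟩
      · exact huv i i (h1.symm.trans h2)
      · exact huv i i (h2.symm.trans h1)
    · rintro x y z ⟨i, ⟨h1, h2⟩ | ⟨h1, h2⟩⟩ ⟨j, ⟨h3, h4⟩ | ⟨h3, h4⟩⟩
      · rw [h2, h4, hu i j (h1.symm.trans h3)]
      · exact absurd (h1.symm.trans h3) (huv i j)
      · exact absurd (h3.symm.trans h1) (huv j i)
      · rw [h2, h4, hv i j (h1.symm.trans h3)]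
    · intro w _
      obtain ⟨i, h1, h2⟩ := Set.mem_iUnion.1 (hcov ▸ Set.mem_univ w)
      have hmem : ∀ x w, x ∈ closedNbhd G w → w ∈ closedNbhd G x := fun x w h => by
        rcases h with h | h
        · exact Or.inl h.symm
        · exact Or.inr h.symm
      exact ⟨u i, v i, ⟨i, Or.inl ⟨rfl, rfl⟩⟩, hmem _ _ h1, hmem _ _ h2⟩

/-! ### A Turing machine that compares all pairs of words of a table -/

namespace TableMachine

open Turing StateTransition

/-- A token: the flag for the end of a word and four data bits. -/
abbrev Tok := Bool × Bool × Bool × Bool × Bool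

/-- The finite control that is run on all pairs of words. -/
structure Control (Q : Type) where
  init : Q
  pair : Q → Option Tok → Tok → Q
  cellEnd : Q → Option Bool → Q
  rowEnd : Q → Bool → Q
  fin : Q → Bool → Q
  accept : Q → Bool

/-- The tokens of a certificate: groups of five bits. -/
def tokens : List Bool → List Tok
  | [] => []
  | a :: l => (a, l.headD false, l.tail.headD false, l.tail.tail.headD false,
      l.tail.tail.tail.headD false) :: tokens l.tail.tail.tail.tail
  termination_by l => l.length
  decreasing_by simp; omega

/-- The words of a list of tokens. -/
def words : List Tok → List (List Tok)
  | [] => []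
  | t :: l => if t.1 then [t] :: words l else
      match words l with
      | [] => [[t]]
      | w :: ws => (t :: w) :: ws

/-- The value of the unary prefix and the remaining bits; the value `1` of the empty word makes
words without a `0` invalid. -/
def unary : List Bool → ℕ × List Bool
  | [] => (1, [])
  | true :: l => ((unary l).1 + 1, (unary l).2)
  | false :: l => (0, l)

/-! ### The function computed by the machine, as a recursion on lists -/

section Semantics

variable {Q : Type} (M : Control Q)

def cellRun : Q → List Tok → List Tok → Q
  | q, _, [] => q
  | q, h, t :: w => cellRun (M.pair q h.head? t) h.tail w

def rowRun (h : List Tok) : Q → List (List Tok) → List Bool → Q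
  | q, [], _ => q
  | q, w :: ws, x => rowRun h (M.cellEnd (cellRun M q h w) x.head?) ws x.tail

def tableRun (ws : List (List Tok)) : Q → List (List Tok) → ℕ → List Bool → Q
  | q, [], n, x => M.fin (M.fin q (n == 0)) x.isEmpty
  | q, h :: hs, n, x =>
    tableRun ws (M.rowEnd (rowRun M h q ws x) (n != 0)) hs (n - 1) (x.drop ws.length)

/-- The result of the machine on the input `x # y`. -/
def result (xy : List Bool × List Bool) : Bool :=
  let ws := words (tokens xy.2).reverse
  M.accept (tableRun M ws M.init ws (unary xy.1).1 (unary xy.1).2.reverse)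

end Semantics

/-- `cnt` and `adj` hold the parsed graph, `rows` and `cols` two copies of the certificate. `cols'`
collects the column tokens already read, and `head`, `head'` share the current row word. -/
inductive Stk
  | inp | cnt | adj | rows | cols | cols' | head | head' | out
  deriving DecidableEq

instance : Fintype Stk :=
  ⟨{.inp, .cnt, .adj, .rows, .cols, .cols', .head, .head', .out}, fun k => by cases k <;> decide⟩

inductive Lbl
  | readCnt | readAdj | readTok | outer | takeHead | inner | restore | compare | back | clear
  | clean
  deriving DecidableEq

instance : Fintype Lbl :=
  ⟨{.readCnt, .readAdj, .readTok, .outer, .takeHead, .inner, .restore, .compare, .back, .clear,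
    .clean}, fun l => by cases l <;> decide⟩

/-- The stack alphabets. -/
abbrev Alph : Stk → Type
  | .inp => Option Bool
  | .cnt => Unit
  | .adj => Bool
  | .out => Bool
  | _ => Tok

/-- The scratch registers. -/
abbrev Reg := Option (Option Bool) × Option Tok × Option Tok

abbrev Code (Q : Type) := TM2.Stmt Alph Lbl (Q × Reg)

section Machine

variable {Q : Type} (M : Control Q)

open TM2.Stmt

/-- The program of the machine. -/
def prog : Lbl → Code Q
  | .readCnt =>
    pop .inp (fun v (s : Option (Option Bool)) => (v.1, s, v.2.2)) <|
    branch (fun v => v.2.1 == some (some true))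
      (push .cnt (fun _ => ()) <| goto fun _ => .readCnt) <|
    branch (fun v => v.2.1 == some (some false))
      (goto fun _ => .readAdj)
      -- The separator came before any `0`. The extra count matches the value of `unary` on the
      -- empty word.
      (push .cnt (fun _ => ()) <| goto fun _ => .readTok)
  | .readAdj =>
    pop .inp (fun v (s : Option (Option Bool)) => (v.1, s, v.2.2)) <|
    branch (fun v => v.2.1.join.isSome)
      (push .adj (fun v => (v.2.1.join.getD false : Bool)) <| goto fun _ => .readAdj)
      (goto fun _ => .readTok)
  | .readTok =>
    pop .inp (fun v (s : Option (Option Bool)) => (v.1, s, v.2.2)) <|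
    branch (fun v => v.2.1.isNone) (goto fun _ => .outer) <|
    load (fun v => (v.1, v.2.1, some (v.2.1.join.getD false, false, false, false, false), none)) <|
    pop .inp (fun v (s : Option (Option Bool)) =>
      (v.1, v.2.1, v.2.2.1.map fun t => (t.1, s.join.getD false, false, false, false), none)) <|
    pop .inp (fun v (s : Option (Option Bool)) =>
      (v.1, v.2.1, v.2.2.1.map fun t => (t.1, t.2.1, s.join.getD false, false, false), none)) <|
    pop .inp (fun v (s : Option (Option Bool)) =>
      (v.1, v.2.1, v.2.2.1.map fun t => (t.1, t.2.1, t.2.2.1, s.join.getD false, false), none)) <|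
    pop .inp (fun v (s : Option (Option Bool)) =>
      (v.1, v.2.1, v.2.2.1.map fun t => (t.1, t.2.1, t.2.2.1, t.2.2.2.1, s.join.getD false),
        none)) <|
    push .rows (fun v => (v.2.2.1.getD default : Tok)) <|
    push .cols (fun v => (v.2.2.1.getD default : Tok)) <|
    goto fun _ => .readTok
  | .outer =>
    peek .rows (fun v (s : Option Tok) => (v.1, v.2.1, s, v.2.2.2)) <|
    branch (fun v => v.2.2.1.isSome) (goto fun _ => .takeHead) <|
    peek .cnt (fun v (s : Option Unit) => (M.fin v.1 s.isNone, v.2)) <|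
    peek .adj (fun v (s : Option Bool) => (M.fin v.1 s.isNone, v.2)) <|
    push .out (fun v => (M.accept v.1 : Bool)) <|
    goto fun _ => .clean
  | .takeHead =>
    pop .rows (fun v (s : Option Tok) => (v.1, v.2.1, s, v.2.2.2)) <|
    branch (fun v => v.2.2.1.isNone) (goto fun _ => .inner) <|
    push .head' (fun v => (v.2.2.1.getD default : Tok)) <|
    branch (fun v => (v.2.2.1.getD default).1) (goto fun _ => .inner) (goto fun _ => .takeHead)
  | .inner =>
    peek .cols (fun v (s : Option Tok) => (v.1, v.2.1, s, v.2.2.2)) <|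
    branch (fun v => v.2.2.1.isNone) (goto fun _ => .back) (goto fun _ => .restore)
  | .restore =>
    pop .head' (fun v (s : Option Tok) => (v.1, v.2.1, s, v.2.2.2)) <|
    branch (fun v => v.2.2.1.isNone) (goto fun _ => .compare) <|
    push .head (fun v => (v.2.2.1.getD default : Tok)) <|
    goto fun _ => .restore
  | .compare =>
    pop .cols (fun v (s : Option Tok) => (v.1, v.2.1, s, v.2.2.2)) <|
    branch (fun v => v.2.2.1.isNone)
      (pop .adj (fun v (s : Option Bool) => (M.cellEnd v.1 s, v.2)) <| goto fun _ => .inner) <|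
    push .cols' (fun v => (v.2.2.1.getD default : Tok)) <|
    pop .head (fun v (s : Option Tok) =>
      (M.pair v.1 s (v.2.2.1.getD default), v.2.1, v.2.2.1, s)) <|
    branch (fun v => v.2.2.2.isSome)
      (push .head' (fun v => (v.2.2.2.getD default : Tok)) <|
        branch (fun v => (v.2.2.1.getD default).1)
          (pop .adj (fun v (s : Option Bool) => (M.cellEnd v.1 s, v.2)) <| goto fun _ => .inner)
          (goto fun _ => .compare))
      (branch (fun v => (v.2.2.1.getD default).1)
          (pop .adj (fun v (s : Option Bool) => (M.cellEnd v.1 s, v.2)) <| goto fun _ => .inner)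
          (goto fun _ => .compare))
  | .back =>
    pop .cols' (fun v (s : Option Tok) => (v.1, v.2.1, s, v.2.2.2)) <|
    branch (fun v => v.2.2.1.isNone) (goto fun _ => .clear) <|
    push .cols (fun v => (v.2.2.1.getD default : Tok)) <|
    goto fun _ => .back
  | .clear =>
    pop .head (fun v (s : Option Tok) => (v.1, v.2.1, s, v.2.2.2)) <|
    pop .head' (fun v (s : Option Tok) => (v.1, v.2.1, v.2.2.1, s)) <|
    branch (fun v => v.2.2.1.isNone && v.2.2.2.isNone)
      (pop .cnt (fun v (s : Option Unit) => (M.rowEnd v.1 s.isSome, v.2)) <| goto fun _ => .outer)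
      (goto fun _ => .clear)
  | .clean =>
    pop .cnt (fun v (s : Option Unit) => (v.1, s.map fun _ => none, v.2.2)) <|
    pop .adj (fun v (s : Option Bool) => (v.1, v.2.1.or (s.map fun _ => none), v.2.2)) <|
    pop .cols (fun v (s : Option Tok) => (v.1, v.2.1.or (s.map fun _ => none), v.2.2)) <|
    branch (fun v => v.2.1.isNone)
      (load (fun _ => (M.init, none, none, none)) halt)
      (goto fun _ => .clean)

/-- The contents of the stacks. -/
def stk (inp : List (Option Bool)) (cnt : List Unit) (adj : List Bool)
    (rows cols cols' head head' : List Tok) (out : List Bool) : ∀ k, List (Alph k)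
  | .inp => inp
  | .cnt => cnt
  | .adj => adj
  | .rows => rows
  | .cols => cols
  | .cols' => cols'
  | .head => head
  | .head' => head'
  | .out => out

section Update

variable (inp : List (Option Bool)) (cnt : List Unit) (adj : List Bool)
    (rows cols cols' head head' : List Tok) (out : List Bool)

local notation "σ₀" => stk inp cnt adj rows cols cols' head head' out

@[simp] theorem stk_inp : σ₀ .inp = inp := rfl
@[simp] theorem stk_cnt : σ₀ .cnt = cnt := rfl
@[simp] theorem stk_adj : σ₀ .adj = adj := rfl
@[simp] theorem stk_rows : σ₀ .rows = rows := rfl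
@[simp] theorem stk_cols : σ₀ .cols = cols := rfl
@[simp] theorem stk_cols' : σ₀ .cols' = cols' := rfl
@[simp] theorem stk_head : σ₀ .head = head := rfl
@[simp] theorem stk_head' : σ₀ .head' = head' := rfl
@[simp] theorem stk_out : σ₀ .out = out := rfl

@[simp] theorem update_inp (l : List (Option Bool)) : Function.update σ₀ .inp l =
    stk l cnt adj rows cols cols' head head' out := by
  funext k; cases k <;> rfl
@[simp] theorem update_cnt (l : List Unit) : Function.update σ₀ .cnt l =
    stk inp l adj rows cols cols' head head' out := by
  funext k; cases k <;> rfl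
@[simp] theorem update_adj (l : List Bool) : Function.update σ₀ .adj l =
    stk inp cnt l rows cols cols' head head' out := by
  funext k; cases k <;> rfl
@[simp] theorem update_rows (l : List Tok) : Function.update σ₀ .rows l =
    stk inp cnt adj l cols cols' head head' out := by
  funext k; cases k <;> rfl
@[simp] theorem update_cols (l : List Tok) : Function.update σ₀ .cols l =
    stk inp cnt adj rows l cols' head head' out := by
  funext k; cases k <;> rfl
@[simp] theorem update_cols' (l : List Tok) : Function.update σ₀ .cols' l =
    stk inp cnt adj rows cols l head head' out := by
  funext k; cases k <;> rfl
@[simp] theorem update_head (l : List Tok) : Function.update σ₀ .head l =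
    stk inp cnt adj rows cols cols' l head' out := by
  funext k; cases k <;> rfl
@[simp] theorem update_head' (l : List Tok) : Function.update σ₀ .head' l =
    stk inp cnt adj rows cols cols' head l out := by
  funext k; cases k <;> rfl
@[simp] theorem update_out (l : List Bool) : Function.update σ₀ .out l =
    stk inp cnt adj rows cols cols' head head' l := by
  funext k; cases k <;> rfl

end Update

/-- From label `l`, control state `q` and stacks `S`, the machine reaches `l'`, `q'`, `S'` within
`B` steps, for arbitrary contents of the scratch registers. -/
def Run (B : ℕ) (l : Lbl) (q : Q) (S : ∀ k, List (Alph k)) (l' : Lbl) (q' : Q)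
    (S' : ∀ k, List (Alph k)) : Prop :=
  ∀ r : Reg, ∃ r' : Reg, Nonempty (EvalsToInTime (TM2.step (prog M))
    ⟨some l, (q, r), S⟩ (some ⟨some l', (q', r'), S'⟩) B)

variable {M}

theorem Run.trans {B₁ B₂ : ℕ} {l₁ l₂ l₃ : Lbl} {q₁ q₂ q₃ : Q} {S₁ S₂ S₃ : ∀ k, List (Alph k)}
    (h₁ : Run M B₁ l₁ q₁ S₁ l₂ q₂ S₂) (h₂ : Run M B₂ l₂ q₂ S₂ l₃ q₃ S₃) :
    Run M (B₁ + B₂) l₁ q₁ S₁ l₃ q₃ S₃ := fun r => by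
  obtain ⟨r₂, ⟨e₁⟩⟩ := h₁ r
  obtain ⟨r₃, ⟨e₂⟩⟩ := h₂ r₂
  exact ⟨r₃, ⟨add_comm B₂ B₁ ▸ e₁.trans _ _ _ _ _ _ e₂⟩⟩

theorem Run.mono {B₁ B₂ : ℕ} {l₁ l₂ : Lbl} {q₁ q₂ : Q} {S₁ S₂ : ∀ k, List (Alph k)}
    (h : Run M B₁ l₁ q₁ S₁ l₂ q₂ S₂) (hB : B₁ ≤ B₂) : Run M B₂ l₁ q₁ S₁ l₂ q₂ S₂ := fun r => by
  obtain ⟨r₂, ⟨e⟩⟩ := h r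
  exact ⟨r₂, ⟨⟨e.toEvalsTo, e.steps_le_m.trans hB⟩⟩⟩

theorem Run.refl (l : Lbl) (q : Q) (S : ∀ k, List (Alph k)) : Run M 0 l q S l q S := fun r =>
  ⟨r, ⟨EvalsToInTime.refl _ _⟩⟩

theorem Run.step {l l' : Lbl} {q q' : Q} {S S' : ∀ k, List (Alph k)}
    (h : ∀ r : Reg, ∃ r' : Reg, TM2.stepAux (prog M l) (q, r) S = ⟨some l', (q', r'), S'⟩) :
    Run M 1 l q S l' q' S' := fun r => by
  obtain ⟨r', hr⟩ := h r
  exact ⟨r', ⟨⟨⟨1, congrArg some hr⟩, le_rfl⟩⟩⟩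

/-! ### Time bounds for the phases of the machine -/

theorem run_readAdj (y : List (Option Bool)) (cnt : List Unit) (q : Q) (x adj : List Bool) :
    Run M (x.length + 1) .readAdj q (stk (x.map some ++ none :: y) cnt adj [] [] [] [] [] [])
      .readTok q (stk y cnt (x.reverse ++ adj) [] [] [] [] [] []) := by
  induction x generalizing adj with
  | nil => exact Run.step fun r => by simp [prog]
  | cons b x ih =>
    have h : Run M 1 .readAdj q
        (stk ((b :: x).map some ++ none :: y) cnt adj [] [] [] [] [] [])
        .readAdj q (stk (x.map some ++ none :: y) cnt (b :: adj) [] [] [] [] [] []) :=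
      Run.step fun r => by simp [prog]
    simpa using (h.trans (ih _)).mono
      (show 1 + (x.length + 1) ≤ (b :: x).length + 1 by simp; omega)

theorem run_readCnt (y : List (Option Bool)) (q : Q) (x : List Bool) (n : ℕ) :
    Run M (x.length + 1) .readCnt q
      (stk (x.map some ++ none :: y) (List.replicate n ()) [] [] [] [] [] [] [])
      .readTok q (stk y (List.replicate ((unary x).1 + n) ()) (unary x).2.reverse
        [] [] [] [] [] []) := by
  induction x generalizing n with
  | nil => exact Run.step fun r => by simp [prog, unary, add_comm 1 n, List.replicate_succ]
  | cons b x ih =>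
    cases b with
    | false =>
      have h : Run M 1 .readCnt q
          (stk ((false :: x).map some ++ none :: y) (List.replicate n ()) [] [] [] [] [] [] [])
          .readAdj q (stk (x.map some ++ none :: y) (List.replicate n ()) []
            [] [] [] [] [] []) :=
        Run.step fun r => by simp [prog]
      simpa [unary] using (h.trans (run_readAdj y _ q x [])).mono
        (show 1 + (x.length + 1) ≤ (false :: x).length + 1 by simp; omega)
    | true =>
      have h : Run M 1 .readCnt q
          (stk ((true :: x).map some ++ none :: y) (List.replicate n ()) [] [] [] [] [] [] [])
          .readCnt q (stk (x.map some ++ none :: y) (List.replicate (n + 1) ()) []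
            [] [] [] [] [] []) :=
        Run.step fun r => by simp [prog, List.replicate_succ]
      have h2 := (h.trans (ih _)).mono (show 1 + (x.length + 1) ≤ (true :: x).length + 1 by
        simp; omega)
      rwa [show (unary x).1 + (n + 1) = (unary (true :: x)).1 + n by simp [unary]; omega] at h2

theorem run_readTok (cnt : List Unit) (adj : List Bool) (q : Q) (y : List Bool)
    (z c : List Tok) :
    Run M (y.length + 1) .readTok q (stk (y.map some) cnt adj z c [] [] [] [])
      .outer q (stk [] cnt adj ((tokens y).reverse ++ z) ((tokens y).reverse ++ c)
        [] [] [] []) := by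
  induction y using tokens.induct generalizing z c with
  | case1 => exact Run.step fun r => by simp [prog, tokens]
  | case2 a l ih =>
    have h : Run M 1 .readTok q (stk ((a :: l).map some) cnt adj z c [] [] [] [])
        .readTok q (stk (l.tail.tail.tail.tail.map some) cnt adj
          ((a, l.headD false, l.tail.headD false, l.tail.tail.headD false,
            l.tail.tail.tail.headD false) :: z)
          ((a, l.headD false, l.tail.headD false, l.tail.tail.headD false,
            l.tail.tail.tail.headD false) :: c) [] [] [] []) :=
      Run.step fun r => by
        rcases l with _ | ⟨b, _ | ⟨c, _ | ⟨d, _ | ⟨e, l⟩⟩⟩⟩ <;> simp [prog]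
    simpa [tokens] using (h.trans (ih _ _)).mono
      (show _ ≤ (a :: l).length + 1 by simp only [List.length_tail, List.length_cons]; omega)

/-- Splits off the first word. Its last token `t` either carries the end flag or is the last token
of the list; all loops over words recurse along this decomposition. -/
theorem words_eq_cons {l : List Tok} (hl : l ≠ []) : ∃ w t l', l = w ++ t :: l' ∧
    (∀ s ∈ w, s.1 = false) ∧ (t.1 = true ∨ l' = []) ∧
    words l = (w ++ [t]) :: words l' := by
  induction l with
  | nil => exact absurd rfl hl
  | cons a l ih =>
    by_cases ha : a.1 = true
    · exact ⟨[], a, l, rfl, by simp, Or.inl ha, by simp [words, ha]⟩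
    · by_cases hl' : l = []
      · subst hl'
        exact ⟨[], a, [], rfl, by simp, Or.inr rfl, by simp [words, ha]⟩
      · obtain ⟨w, t, l', h1, h2, h3, h4⟩ := ih hl'
        refine ⟨a :: w, t, l', by simp [h1], ?_, h3, ?_⟩
        · simpa [ha] using h2
        · rw [words, if_neg ha, h4]
          rfl

theorem run_takeHead (cnt : List Unit) (adj : List Bool) (cols : List Tok) (q : Q)
    (w : List Tok) (t : Tok) (l : List Tok) (hw : ∀ s ∈ w, s.1 = false)
    (ht : t.1 = true ∨ l = []) (k : List Tok) :
    Run M (w.length + 2) .takeHead q (stk [] cnt adj (w ++ t :: l) cols [] [] k [])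
      .inner q (stk [] cnt adj l cols [] [] (t :: w.reverse ++ k) []) := by
  induction w generalizing k with
  | nil =>
    by_cases h : t.1 = true
    · exact (Run.step fun r => by simp [prog, h]).mono (show 1 ≤ 2 by omega)
    · obtain rfl := ht.resolve_left h
      have h1 : Run M 1 .takeHead q (stk [] cnt adj ([] ++ [t]) cols [] [] k [])
          .takeHead q (stk [] cnt adj [] cols [] [] (t :: k) []) :=
        Run.step fun r => by simp [prog, h]
      exact h1.trans (Run.step fun r => by simp [prog])
  | cons s w ih =>
    have hs : s.1 = false := hw s (by simp)
    have h1 : Run M 1 .takeHead q (stk [] cnt adj (s :: w ++ t :: l) cols [] [] k [])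
        .takeHead q (stk [] cnt adj (w ++ t :: l) cols [] [] (s :: k) []) :=
      Run.step fun r => by simp [prog, hs]
    simpa using (h1.trans (ih (fun s hs => hw s (by simp [hs])) _)).mono
      (show _ ≤ (s :: w).length + 2 by simp; omega)

theorem run_restore (cnt : List Unit) (adj : List Bool) (rows cols cols' : List Tok) (q : Q)
    (k h : List Tok) :
    Run M (k.length + 1) .restore q (stk [] cnt adj rows cols cols' h k [])
      .compare q (stk [] cnt adj rows cols cols' (k.reverse ++ h) [] []) := by
  induction k generalizing h with
  | nil => exact Run.step fun r => by simp [prog]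
  | cons s k ih =>
    have h1 : Run M 1 .restore q (stk [] cnt adj rows cols cols' h (s :: k) [])
        .restore q (stk [] cnt adj rows cols cols' (s :: h) k []) :=
      Run.step fun r => by simp [prog]
    simpa using (h1.trans (ih _)).mono (show _ ≤ (s :: k).length + 1 by simp; omega)

/-- Head tokens only move from `head` to `head'`, so `k.reverse ++ h` is invariant and the row word
can be restored for the next column, even if the column word was shorter. -/
theorem run_compare (cnt : List Unit) (adj : List Bool) (rows : List Tok)
    (w : List Tok) (t : Tok) (l : List Tok) (hw : ∀ s ∈ w, s.1 = false)
    (ht : t.1 = true ∨ l = []) (q : Q) (cols' h k : List Tok) :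
    ∃ h' k' : List Tok, k'.reverse ++ h' = k.reverse ++ h ∧
    Run M (w.length + 2) .compare q (stk [] cnt adj rows (w ++ t :: l) cols' h k [])
      .inner (M.cellEnd (cellRun M q h (w ++ [t])) adj.head?)
      (stk [] cnt adj.tail rows l (t :: w.reverse ++ cols') h' k' []) := by
  induction w generalizing q cols' h k with
  | nil =>
    refine ⟨h.tail, h.head?.toList ++ k, by cases h <;> simp, ?_⟩
    by_cases hf : t.1 = true
    · refine (Run.step fun r => ?_).mono (show 1 ≤ 2 by omega)
      cases h <;> simp [prog, hf, cellRun]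
    · obtain rfl := ht.resolve_left hf
      have h1 : Run M 1 .compare q (stk [] cnt adj rows ([] ++ [t]) cols' h k [])
          .compare (M.pair q h.head? t) (stk [] cnt adj rows [] (t :: cols') h.tail
            (h.head?.toList ++ k) []) :=
        Run.step fun r => by cases h <;> simp [prog, hf]
      exact h1.trans (Run.step fun r => by simp [prog, cellRun])
  | cons s w ih =>
    have hs : s.1 = false := hw s (by simp)
    have h1 : Run M 1 .compare q (stk [] cnt adj rows (s :: w ++ t :: l) cols' h k [])
        .compare (M.pair q h.head? s) (stk [] cnt adj rows (w ++ t :: l) (s :: cols') h.tail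
          (h.head?.toList ++ k) []) :=
      Run.step fun r => by cases h <;> simp [prog, hs]
    obtain ⟨h', k', he, h2⟩ := ih (fun s hs => hw s (by simp [hs])) (M.pair q h.head? s)
      (s :: cols') h.tail (h.head?.toList ++ k)
    refine ⟨h', k', he.trans (by cases h <;> simp), ?_⟩
    simpa [cellRun] using (h1.trans h2).mono (show _ ≤ (s :: w).length + 2 by simp; omega)

theorem run_inner (cnt : List Unit) (rows hd : List Tok) (cols : List Tok) (adj : List Bool)
    (q : Q) (cols' h k : List Tok) (hk : k.reverse ++ h = hd) :
    ∃ h' k' : List Tok, k'.reverse ++ h' = hd ∧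
    Run M (cols.length * (hd.length + 4) + 1) .inner q (stk [] cnt adj rows cols cols' h k [])
      .back (rowRun M hd q (words cols) adj)
      (stk [] cnt (adj.drop (words cols).length) rows [] (cols.reverse ++ cols') h' k' []) := by
  induction hN : cols.length using Nat.strong_induction_on generalizing cols adj q cols' h k with
  | _ N ih =>
  subst hN
  by_cases hc : cols = []
  · subst hc
    exact ⟨h, k, hk, (Run.step fun r => by simp [prog, words, rowRun]).mono (by simp)⟩
  · obtain ⟨w, t, l, rfl, hw, ht, hwords⟩ := words_eq_cons hc
    have h1 : Run M 1 .inner q (stk [] cnt adj rows (w ++ t :: l) cols' h k [])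
        .restore q (stk [] cnt adj rows (w ++ t :: l) cols' h k []) :=
      Run.step fun r => by cases w <;> simp [prog]
    have h2 := run_restore (M := M) cnt adj rows (w ++ t :: l) cols' q k h
    rw [hk] at h2
    obtain ⟨h', k', he, h3⟩ := run_compare (M := M) cnt adj rows w t l hw ht q cols' hd []
    obtain ⟨h'', k'', he', h4⟩ := ih _ (by simp; omega) l adj.tail
      (M.cellEnd (cellRun M q hd (w ++ [t])) adj.head?) (t :: w.reverse ++ cols') h' k'
      (by simpa using he) rfl
    refine ⟨h'', k'', he', ?_⟩
    have hkl : k.length ≤ hd.length := by rw [← hk]; simp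
    have := (((h1.trans h2).trans h3).trans h4).mono
      -- The word `w ++ [t]` costs one step at `inner`, at most `hd.length + 1` for restoring and
      -- `w.length + 2` for comparing, which is at most `(w.length + 1) * (hd.length + 4)`.
      (show _ ≤ (w ++ t :: l).length * (hd.length + 4) + 1 by
        simp only [List.length_append, List.length_cons]
        nlinarith)
    simpa [hwords, rowRun, List.drop_tail] using this

theorem run_back (cnt : List Unit) (adj : List Bool) (rows h k : List Tok) (q : Q)
    (cols' cols : List Tok) :
    Run M (cols'.length + 1) .back q (stk [] cnt adj rows cols cols' h k [])
      .clear q (stk [] cnt adj rows (cols'.reverse ++ cols) [] h k []) := by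
  induction cols' generalizing cols with
  | nil => exact Run.step fun r => by simp [prog]
  | cons s c ih =>
    have h1 : Run M 1 .back q (stk [] cnt adj rows cols (s :: c) h k [])
        .back q (stk [] cnt adj rows (s :: cols) c h k []) :=
      Run.step fun r => by simp [prog]
    simpa using (h1.trans (ih _)).mono (show _ ≤ (s :: c).length + 1 by simp; omega)

theorem run_clear (cnt : List Unit) (adj : List Bool) (rows cols : List Tok) (q : Q)
    (h k : List Tok) :
    Run M (h.length + k.length + 1) .clear q (stk [] cnt adj rows cols [] h k [])
      .outer (M.rowEnd q cnt.head?.isSome) (stk [] cnt.tail adj rows cols [] [] [] []) := by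
  induction hN : h.length + k.length using Nat.strong_induction_on generalizing h k with
  | _ N ih =>
  by_cases h0 : h = [] ∧ k = []
  · obtain ⟨rfl, rfl⟩ := h0
    exact (Run.step fun r => by simp [prog]).mono (by omega)
  · have h1 : Run M 1 .clear q (stk [] cnt adj rows cols [] h k [])
        .clear q (stk [] cnt adj rows cols [] h.tail k.tail []) :=
      Run.step fun r => by
        cases h <;> cases k <;> simp_all [prog]
    have hlt : h.tail.length + k.tail.length < N := by
      cases h <;> cases k <;> simp_all <;> omega
    exact (h1.trans (ih _ hlt _ _ rfl)).mono (by omega)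

/-- The final state and the leftovers on `cnt` and `adj` are left unspecified, since the cleaning
phase discards them; only their size matters for the time bound. -/
theorem run_outer (cols rows : List Tok) (n : ℕ) (adj : List Bool) (q : Q) :
    ∃ (q' : Q) (n' : ℕ) (adj' : List Bool), n' ≤ n ∧ adj'.length ≤ adj.length ∧
    Run M (rows.length * (6 * cols.length + 7) + 1) .outer q
      (stk [] (List.replicate n ()) adj rows cols [] [] [] [])
      .clean q' (stk [] (List.replicate n' ()) adj' [] cols [] [] []
        [M.accept (tableRun M (words cols) q (words rows) n adj)]) := by
  induction hN : rows.length using Nat.strong_induction_on generalizing rows n adj q with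
  | _ N ih =>
  subst hN
  by_cases hr : rows = []
  · subst hr
    refine ⟨M.fin (M.fin q (n == 0)) adj.isEmpty, n, adj, le_rfl, le_rfl,
      (Run.step fun r => ?_).mono (by simp)⟩
    cases n <;> cases adj <;> simp [prog, words, tableRun, List.replicate_succ]
  · obtain ⟨w, t, l, rfl, hw, ht, hwords⟩ := words_eq_cons hr
    have h1 : Run M 1 .outer q (stk [] (List.replicate n ()) adj (w ++ t :: l) cols [] [] [] [])
        .takeHead q (stk [] (List.replicate n ()) adj (w ++ t :: l) cols [] [] [] []) :=
      Run.step fun r => by cases w <;> simp [prog]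
    have h2 := run_takeHead (M := M) (List.replicate n ()) adj cols q w t l hw ht []
    obtain ⟨h', k', he, h3⟩ := run_inner (M := M) (List.replicate n ()) l (w ++ [t]) cols adj q []
      [] (t :: w.reverse ++ []) (by simp)
    have h4 := run_back (M := M) (List.replicate n ()) (adj.drop (words cols).length) l h' k'
      (rowRun M (w ++ [t]) q (words cols) adj) (cols.reverse ++ []) []
    have h5 := run_clear (M := M) (List.replicate n ()) (adj.drop (words cols).length) l cols
      (rowRun M (w ++ [t]) q (words cols) adj) h' k'
    obtain ⟨q', n', adj', hn', hadj', h6⟩ := ih _ (by simp; omega) l (n - 1)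
      (adj.drop (words cols).length)
      (M.rowEnd (rowRun M (w ++ [t]) q (words cols) adj) (List.replicate n ()).head?.isSome) rfl
    have hlen : h'.length + k'.length = w.length + 1 := by
      have := congrArg List.length he
      simp at this
      omega
    refine ⟨q', n', adj', hn'.trans (Nat.sub_le _ _), hadj'.trans (by simp), ?_⟩
    simp only [List.append_nil, List.reverse_reverse, List.length_reverse] at h4
    have h56 := h5.trans (by simpa using h6)
    have := ((((h1.trans h2).trans h3).trans (by simpa using h4)).trans h56).mono
      (show _ ≤ (w ++ t :: l).length * (6 * cols.length + 7) + 1 by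
        rw [hlen]
        simp only [List.length_append, List.length_cons, List.length_nil]
        nlinarith [Nat.zero_le (w.length * cols.length)])
    have hn0 : (List.replicate n ()).head?.isSome = (n != 0) := by
      cases n <;> simp [List.replicate_succ]
    rw [hn0] at this
    simpa only [hwords, tableRun] using this

/-- `haltList` demands the initial state and empty stacks apart from the output, so `cnt`, `adj` and
`cols` have to be emptied before halting. -/
theorem evals_clean (cnt : List Unit) (adj : List Bool) (cols : List Tok) (q : Q) (b : Bool)
    (r : Reg) : Nonempty (EvalsToInTime (TM2.step (prog M))
      ⟨some .clean, (q, r), stk [] cnt adj [] cols [] [] [] [b]⟩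
      (some ⟨none, (M.init, none, none, none), stk [] [] [] [] [] [] [] [] [b]⟩)
      (cnt.length + adj.length + cols.length + 1)) := by
  induction hN : cnt.length + adj.length + cols.length using Nat.strong_induction_on
    generalizing cnt adj cols r with
  | _ N ih =>
  by_cases h0 : cnt = [] ∧ adj = [] ∧ cols = []
  · obtain ⟨rfl, rfl, rfl⟩ := h0
    exact ⟨⟨⟨1, by simp [flip, prog]⟩, Nat.succ_le_succ (Nat.zero_le _)⟩⟩
  · have hlt : cnt.tail.length + adj.tail.length + cols.tail.length < N := by
      cases cnt <;> cases adj <;> cases cols <;> simp_all <;> omega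
    have h1 : ∃ r', TM2.stepAux (prog M .clean) (q, r) (stk [] cnt adj [] cols [] [] [] [b]) =
        ⟨some .clean, (q, r'), stk [] cnt.tail adj.tail [] cols.tail [] [] [] [b]⟩ := by
      cases cnt <;> cases adj <;> cases cols <;> simp_all [prog]
    obtain ⟨r', hr'⟩ := h1
    obtain ⟨e⟩ := ih _ hlt _ _ _ r' rfl
    have e1 : EvalsToInTime (TM2.step (prog M))
      ⟨some .clean, (q, r), stk [] cnt adj [] cols [] [] [] [b]⟩
      (some ⟨some .clean, (q, r'), stk [] cnt.tail adj.tail [] cols.tail [] [] [] [b]⟩) 1 :=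
      ⟨⟨1, congrArg some hr'⟩, le_rfl⟩
    have e2 := e1.trans _ _ _ _ _ _ e
    exact ⟨⟨e2.toEvalsTo, e2.steps_le_m.trans (by omega)⟩⟩

theorem unary_length (x : List Bool) : (unary x).1 + (unary x).2.length ≤ x.length + 1 := by
  induction x with
  | nil => simp [unary]
  | cons b x ih => cases b <;> simp only [unary, List.length_cons] <;> omega

theorem tokens_length (y : List Bool) : (tokens y).length ≤ y.length := by
  induction y using tokens.induct with
  | case1 => simp [tokens]
  | case2 a l ih =>
    simp only [tokens, List.length_cons]
    simp only [List.length_tail] at ih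
    omega

/-- The machine. -/
def machine (M : Control Q) [Fintype Q] : FinTM2 where
  K := Stk
  k₀ := .inp
  k₁ := .out
  Γ := Alph
  Λ := Lbl
  main := .readCnt
  σ := Q × Reg
  initialState := (M.init, none, none, none)
  Γk₀Fin := inferInstanceAs (Fintype (Option Bool))
  m := prog M

theorem machine_outputs [Fintype Q] (x y : List Bool) :
    Nonempty (TM2OutputsInTime (machine M) (pairCode (x, y)) (some [result M (x, y)])
      (6 * (pairCode (x, y)).length ^ 2 + 12 * (pairCode (x, y)).length + 10)) := by
  have h1 := run_readCnt (M := M) (y.map some) M.init x 0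
  have h2 := run_readTok (M := M) (List.replicate ((unary x).1 + 0) ()) (unary x).2.reverse
    M.init y [] []
  obtain ⟨q', n', adj', hn', hadj', h3⟩ := run_outer (M := M) ((tokens y).reverse ++ [])
    ((tokens y).reverse ++ []) ((unary x).1 + 0) (unary x).2.reverse M.init
  obtain ⟨r', ⟨e1⟩⟩ := ((h1.trans h2).trans h3) (none, none, none)
  obtain ⟨e2⟩ := evals_clean (M := M) (List.replicate n' ()) adj' ((tokens y).reverse ++ []) q'
    (M.accept (tableRun M (words ((tokens y).reverse ++ [])) M.init
      (words ((tokens y).reverse ++ [])) ((unary x).1 + 0) (unary x).2.reverse)) r'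
  have e := e1.trans _ _ _ _ _ _ e2
  have hx := unary_length x
  have hy := tokens_length y
  have hinit : initList (machine M) (pairCode (x, y)) = ⟨some .readCnt,
      (M.init, none, none, none),
      stk (x.map some ++ none :: y.map some) (List.replicate 0 ()) [] [] [] [] [] [] []⟩ := by
    unfold initList
    congr 1
    funext k
    cases k <;> rfl
  have hhalt : haltList (machine M) [result M (x, y)] = ⟨none, (M.init, none, none, none),
      stk [] [] [] [] [] [] [] [] [result M (x, y)]⟩ := by
    unfold haltList
    congr 1
    funext k
    cases k <;> rfl
  refine ⟨⟨⟨e.steps, ?_⟩, e.steps_le_m.trans ?_⟩⟩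
  · rw [hinit, Option.map_some, hhalt]
    have := e.evals_in_steps
    simp only [List.append_nil, add_zero] at this
    exact this
  · simp only [List.length_append, List.length_nil, List.length_reverse, List.length_replicate,
      add_zero] at hadj' hn' ⊢
    simp only [pairCode, List.length_append, List.length_map, List.length_cons]
    nlinarith [Nat.mul_le_mul hy hy]

theorem nonempty_polyTime [Fintype Q] (M : Control Q) :
    Nonempty (TM2ComputableInPolyTime pairCode Computability.encodeBool (result M)) :=
  ⟨{ tm := machine M
     inputAlphabet := Equiv.refl _
     outputAlphabet := Equiv.refl _
     time := 6 * Polynomial.X ^ 2 + 12 * Polynomial.X + 10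
     outputsFun := fun xy => by
      have h := (machine_outputs (M := M) xy.1 xy.2).some
      have h1 : List.map (Equiv.refl (Option Bool)).invFun (pairCode xy) = pairCode xy :=
        List.map_id _
      have h2 : (6 * Polynomial.X ^ 2 + 12 * Polynomial.X + 10 : Polynomial ℕ).eval
          (pairCode xy).length = 6 * (pairCode xy).length ^ 2 + 12 * (pairCode xy).length + 10 := by
        simp
      rw [h2]
      exact h1.symm ▸ h }⟩

end Machine

/-! ### The verifier -/

/-- The state of the comparison of two words `h` and `w`. -/
structure Cell where
  len : Bool
  ov : Bool
  eqC : Bool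
  eqT : Bool
  eqI : Bool
  seen : Bool
  past : Bool
  bad : Bool

def Cell.init : Cell := ⟨true, false, true, true, true, false, false, false⟩

/-- After the end flag, the bits of a token belong to four tracks: interval, colour, target colour,
identity. `eqT` compares the target of `h` with the colour of `w`. The flags `seen`, `past`, `bad`
detect the pattern `1…0…1` in the interval track of `w`. -/
def Cell.step (c : Cell) (h : Option Tok) (t : Tok) : Cell where
  len := c.len && h.isSome
  ov := c.ov || (h.any (fun s => s.2.1) && t.2.1)
  eqC := c.eqC && h.any (fun s => s.2.2.1 == t.2.2.1)
  eqT := c.eqT && h.any (fun s => s.2.2.2.1 == t.2.2.1)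
  eqI := c.eqI && h.any (fun s => s.2.2.2.2 == t.2.2.2.2)
  seen := c.seen || t.2.1
  past := c.past || (c.seen && !t.2.1)
  bad := c.bad || (c.past && t.2.1)

def Cell.scan : Cell → List Tok → List Tok → Cell
  | c, _, [] => c
  | c, h, t :: w => Cell.scan (c.step h.head? t) h.tail w

/-- A saturating counter. -/
def sat (n : ℕ) : Fin 4 := ⟨min n 3, by omega⟩

def bump (c : Fin 4) (b : Bool) : Fin 4 := sat (c.val + b.toNat)

theorem bump_sat (n : ℕ) (b : Bool) : bump (sat n) b = sat (n + b.toNat) := by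
  cases b
  · simp [bump, sat]
  · simp [bump, sat]
    omega

/-- The state of the verifier; `row` counts the words with the same identity, with the same colour,
and with the target colour. -/
structure State where
  ok : Bool
  cell : Cell
  row : Fin 4 × Fin 4 × Fin 4

instance : Finite Cell :=
  Finite.of_injective (fun c => (c.len, c.ov, c.eqC, c.eqT, c.eqI, c.seen, c.past, c.bad)) <| by
    rintro ⟨⟩ ⟨⟩ h
    simpa using h

instance : Finite State :=
  Finite.of_injective (fun c => (c.ok, c.cell, c.row)) <| by
    rintro ⟨⟩ ⟨⟩ h
    simpa using h

/-- The adjacency bit of two words. -/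
def Cell.bit (c : Cell) : Bool := c.ov && !c.eqI

def Cell.valid (c : Cell) : Bool := c.len && c.seen && !c.bad

/-- Per row: exactly one word has the same identity, at most two have the same colour, and at least
two overlapping words have the target colour. Counters saturating at `3` decide these conditions. -/
def control : Control State where
  init := ⟨true, .init, sat 0, sat 0, sat 0⟩
  pair q h t := { q with cell := q.cell.step h t }
  cellEnd q b := ⟨q.ok && (q.cell.valid && b == some q.cell.bit), .init,
    bump q.row.1 q.cell.eqI, bump q.row.2.1 q.cell.eqC, bump q.row.2.2 (q.cell.eqT && q.cell.ov)⟩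
  rowEnd q c := ⟨q.ok && (c && (q.row.1 == 1 && q.row.2.1 ≤ 2 && 2 ≤ q.row.2.2)), .init,
    sat 0, sat 0, sat 0⟩
  fin q b := { q with ok := q.ok && b }
  accept q := q.ok

/-- The comparison of two words. -/
def comparison (h w : List Tok) : Cell := Cell.init.scan h w

theorem cellRun_control (q : State) (h w : List Tok) :
    cellRun control q h w = { q with cell := q.cell.scan h w } := by
  induction w generalizing q h with
  | nil => rfl
  | cons t w ih => rw [cellRun, ih]; rfl

theorem rowRun_control (h : List Tok) (ok : Bool) (a b c : ℕ) (ws : List (List Tok))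
    (x : List Bool) :
    rowRun control h ⟨ok, .init, sat a, sat b, sat c⟩ ws x =
      ⟨ok && (ws.all (fun w => (comparison h w).valid) &&
          (ws.map fun w => (comparison h w).bit).isPrefixOf x), .init,
        sat (a + ws.countP fun w => (comparison h w).eqI),
        sat (b + ws.countP fun w => (comparison h w).eqC),
        sat (c + ws.countP fun w => (comparison h w).eqT && (comparison h w).ov)⟩ := by
  induction ws generalizing ok a b c x with
  | nil => simp [rowRun]
  | cons w ws ih =>
    rw [rowRun, cellRun_control]
    simp only [control, bump_sat]
    have := ih (ok && ((Cell.init.scan h w).valid && x.head? == some (Cell.init.scan h w).bit))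
      (a + (Cell.init.scan h w).eqI.toNat) (b + (Cell.init.scan h w).eqC.toNat)
      (c + ((Cell.init.scan h w).eqT && (Cell.init.scan h w).ov).toNat) x.tail
    simp only [control] at this
    rw [this]
    have hb (n m : ℕ) (b : Bool) : n + b.toNat + m = n + (m + if b then 1 else 0) := by
      cases b
      · simp
      · simp
        omega
    simp only [List.countP_cons, List.map_cons, List.all_cons, hb, comparison]
    congr 1
    cases x with
    | nil => simp [List.isPrefixOf]
    | cons y x =>
      simp only [List.head?_cons, List.tail_cons, List.isPrefixOf]
      rw [Bool.eq_iff_iff]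
      simp
      grind

/-- The condition checked on the row of the word `h`. -/
def RowOk (ws : List (List Tok)) (h : List Tok) : Prop :=
  (∀ w ∈ ws, (comparison h w).valid) ∧
    (ws.countP fun w => (comparison h w).eqI) = 1 ∧
    (ws.countP fun w => (comparison h w).eqC) ≤ 2 ∧
    2 ≤ ws.countP fun w => (comparison h w).eqT && (comparison h w).ov

theorem tableRun_control (ws hs : List (List Tok)) (ok : Bool) (n : ℕ) (x : List Bool) :
    control.accept (tableRun control ws ⟨ok, .init, sat 0, sat 0, sat 0⟩ hs n x) = true ↔
      ok = true ∧ n = hs.length ∧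
        x = (hs.flatMap fun h => ws.map fun w => (comparison h w).bit) ∧ ∀ h ∈ hs, RowOk ws h := by
  induction hs generalizing ok n x with
  | nil => simp [tableRun, control]; grind
  | cons h hs ih =>
    rw [tableRun, rowRun_control]
    have h1 (m : ℕ) : sat m = 1 ↔ m = 1 := by simp [sat, Fin.ext_iff]; omega
    have h2 (m : ℕ) : sat m ≤ 2 ↔ m ≤ 2 := by simp [sat, Fin.le_def]
    have h3 (m : ℕ) : 2 ≤ sat m ↔ 2 ≤ m := by simp [sat, Fin.le_def]
    -- The matrix is checked row by row: one row is a prefix of the remaining bits, and the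
    -- recursion handles what is left after dropping it.
    have h4 (l m : List Bool) (r : List Bool) (hl : l.length = ws.length) :
        (l <+: r ∧ r.drop ws.length = m) ↔ r = l ++ m := by
      constructor
      · rintro ⟨⟨s, rfl⟩, rfl⟩
        simp [← hl]
      · rintro rfl
        simp [← hl]
    simp only [control] at ih ⊢
    rw [ih, List.flatMap_cons, ← h4 _ _ _ (by simp)]
    simp only [Bool.and_eq_true, List.all_eq_true, List.isPrefixOf_iff_prefix, beq_iff_eq,
      decide_eq_true_eq, zero_add, h1, h2, h3, List.mem_cons, forall_eq_or_imp, List.length_cons,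
      bne_iff_ne, RowOk, ne_eq]
    have h5 : n = hs.length + 1 ↔ n ≠ 0 ∧ n - 1 = hs.length := by omega
    rw [h5]
    tauto

/-! #### The comparison of two words -/

/-- The bit `t` of the first track of a word. -/
def track (w : List Tok) (t : ℕ) : Bool := (w.getD t default).2.1

@[simp] theorem track_nil (t : ℕ) : track [] t = false := rfl
@[simp] theorem track_cons_zero (s : Tok) (w : List Tok) : track (s :: w) 0 = s.2.1 := rfl
@[simp] theorem track_cons_succ (s : Tok) (w : List Tok) (t : ℕ) :
    track (s :: w) (t + 1) = track w t := rfl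

theorem scan_len (c : Cell) (h w : List Tok) :
    (c.scan h w).len = (c.len && decide (w.length ≤ h.length)) := by
  induction w generalizing c h with
  | nil => simp [Cell.scan]
  | cons t w ih => cases h <;> simp [Cell.scan, ih, Cell.step]

theorem scan_ov (c : Cell) (h w : List Tok) :
    (c.scan h w).ov = true ↔ c.ov = true ∨ ∃ t, track h t = true ∧ track w t = true := by
  induction w generalizing c h with
  | nil => simp [Cell.scan]
  | cons s w ih =>
    rw [Cell.scan, ih, ← Nat.or_exists_add_one (p := fun t => track h t = true ∧ _)]
    cases h <;> simp [Cell.step, or_assoc]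

theorem scan_eqC (c : Cell) (h w : List Tok) (hl : w.length = h.length) :
    (c.scan h w).eqC = true ↔
      c.eqC = true ∧ h.map (fun s => s.2.2.1) = w.map (fun s => s.2.2.1) := by
  induction w generalizing c h with
  | nil => cases h <;> simp_all [Cell.scan]
  | cons s w ih => cases h <;> simp_all [Cell.scan, Cell.step, and_assoc]

theorem scan_eqT (c : Cell) (h w : List Tok) (hl : w.length = h.length) :
    (c.scan h w).eqT = true ↔
      c.eqT = true ∧ h.map (fun s => s.2.2.2.1) = w.map (fun s => s.2.2.1) := by
  induction w generalizing c h with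
  | nil => cases h <;> simp_all [Cell.scan]
  | cons s w ih => cases h <;> simp_all [Cell.scan, Cell.step, and_assoc]

theorem scan_eqI (c : Cell) (h w : List Tok) (hl : w.length = h.length) :
    (c.scan h w).eqI = true ↔
      c.eqI = true ∧ h.map (fun s => s.2.2.2.2) = w.map (fun s => s.2.2.2.2) := by
  induction w generalizing c h with
  | nil => cases h <;> simp_all [Cell.scan]
  | cons s w ih => cases h <;> simp_all [Cell.scan, Cell.step, and_assoc]

theorem scan_seen (c : Cell) (h w : List Tok) :
    (c.scan h w).seen = true ↔ c.seen = true ∨ ∃ t, track w t = true := by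
  induction w generalizing c h with
  | nil => simp [Cell.scan]
  | cons s w ih =>
    rw [Cell.scan, ih, ← Nat.or_exists_add_one (p := fun t => track (s :: w) t = true)]
    simp [Cell.step, or_assoc]

/-- The forbidden pattern `1…0…1` may be completed with two, one or none of its symbols read before
the scan; these cases are the disjuncts with `past`, with `seen`, and the last one. -/
theorem scan_bad (c : Cell) (h w : List Tok) :
    (c.scan h w).bad = true ↔ c.bad = true ∨ (c.past = true ∧ ∃ k, track w k = true) ∨
      (c.seen = true ∧ ∃ j k, j < k ∧ track w j = false ∧ track w k = true) ∨
      ∃ i j k, i < j ∧ j < k ∧ track w i = true ∧ track w j = false ∧ track w k = true := by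
  induction w generalizing c h with
  | nil => simp [Cell.scan]
  | cons s w ih =>
    rw [Cell.scan, ih, ← Nat.or_exists_add_one (p := fun t => track (s :: w) t = true)]
    have h1 (v : List Tok) : (∃ j k, j < k ∧ track (s :: v) j = false ∧ track (s :: v) k = true) ↔
        (s.2.1 = false ∧ ∃ k, track v k = true) ∨
          ∃ j k, j < k ∧ track v j = false ∧ track v k = true := by
      rw [← Nat.or_exists_add_one]
      refine or_congr ?_ (exists_congr fun j => ?_) <;> rw [← Nat.or_exists_add_one] <;> simp
    have h2 : (∃ i j k, i < j ∧ j < k ∧ track (s :: w) i = true ∧ track (s :: w) j = false ∧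
          track (s :: w) k = true) ↔
        (s.2.1 = true ∧ ∃ j k, j < k ∧ track w j = false ∧ track w k = true) ∨
        ∃ i j k, i < j ∧ j < k ∧ track w i = true ∧ track w j = false ∧ track w k = true := by
      rw [← Nat.or_exists_add_one]
      refine or_congr ?_ (exists_congr fun i => ?_) <;> rw [← Nat.or_exists_add_one]
      · simp only [lt_irrefl, false_and, exists_false, false_or, ← exists_and_left]
        refine exists_congr fun j => ?_
        rw [← Nat.or_exists_add_one]
        simp
        tauto
      · simp only [not_lt_zero, false_and, exists_false, false_or]
        refine exists_congr fun j => ?_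
        rw [← Nat.or_exists_add_one]
        simp
    rw [h1, h2]
    simp only [Cell.step, track_cons_zero, track_cons_succ, Bool.or_eq_true, Bool.and_eq_true,
      Bool.not_eq_true']
    generalize (∃ i j k, i < j ∧ j < k ∧ track w i = true ∧ track w j = false ∧
      track w k = true) = p
    generalize (∃ j k, j < k ∧ track w j = false ∧ track w k = true) = p'
    generalize (∃ k, track w k = true) = p''
    cases s.2.1 <;> simp <;> tauto

theorem comparison_valid (h w : List Tok) :
    (comparison h w).valid = true ↔ w.length ≤ h.length ∧ (∃ t, track w t = true) ∧
      ∀ i j k, i < j → j < k → track w i = true → track w k = true → track w j = true := by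
  simp only [Cell.valid, comparison, Bool.and_eq_true, scan_len, scan_seen, Bool.not_eq_true',
    ← Bool.not_eq_true, scan_bad]
  simp only [Cell.init, true_and, decide_eq_true_eq, and_assoc, Bool.false_eq_true, false_or,
    false_and]
  refine and_congr_right fun _ => and_congr_right fun _ => ?_
  push Not
  grind

theorem exists_track_iff_le {w : List Tok} (hex : ∃ t, track w t = true)
    (hc : ∀ i j k, i < j → j < k → track w i = true → track w k = true → track w j = true) :
    ∃ l r, l ≤ r ∧ ∀ t, track w t = true ↔ l ≤ t ∧ t ≤ r := by
  have hlt (t : ℕ) (ht : track w t = true) : t ≤ w.length := by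
    by_contra! h
    simp [track, List.getElem?_eq_none h.le] at ht
    exact absurd ht (by decide)
  obtain ⟨t, ht⟩ := id hex
  have hf := Nat.find_spec hex
  have hg : track w (Nat.findGreatest (fun t => track w t = true) w.length) = true :=
    Nat.findGreatest_spec (P := fun t => track w t = true) (hlt t ht) ht
  refine ⟨Nat.find hex, Nat.findGreatest (fun t => track w t = true) w.length,
    (Nat.find_min' hex ht).trans (Nat.le_findGreatest (hlt t ht) ht), fun s =>
    ⟨fun hs => ⟨Nat.find_min' hex hs, Nat.le_findGreatest (hlt s hs) hs⟩, ?_⟩⟩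
  rintro ⟨h1, h2⟩
  rcases h1.eq_or_lt with h1 | h1
  · exact h1 ▸ hf
  rcases h2.eq_or_lt with h2 | h2
  · exact h2 ▸ hg
  exact hc _ s _ h1 h2 hf hg

theorem comparison_ov (h w : List Tok) :
    (comparison h w).ov = true ↔ ∃ t, track h t = true ∧ track w t = true := by
  simp [comparison, scan_ov, Cell.init]

theorem comparison_eqC {h w : List Tok} (hl : w.length = h.length) :
    (comparison h w).eqC = true ↔ h.map (fun s => s.2.2.1) = w.map (fun s => s.2.2.1) := by
  simp [comparison, scan_eqC _ _ _ hl, Cell.init]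

theorem comparison_eqT {h w : List Tok} (hl : w.length = h.length) :
    (comparison h w).eqT = true ↔ h.map (fun s => s.2.2.2.1) = w.map (fun s => s.2.2.1) := by
  simp [comparison, scan_eqT _ _ _ hl, Cell.init]

theorem comparison_eqI {h w : List Tok} (hl : w.length = h.length) :
    (comparison h w).eqI = true ↔ h.map (fun s => s.2.2.2.2) = w.map (fun s => s.2.2.2.2) := by
  simp [comparison, scan_eqI _ _ _ hl, Cell.init]

/-- What the verifier accepts. -/
theorem result_control (x y : List Bool) :
    result control (x, y) = true ↔ (unary x).1 = (words (tokens y).reverse).length ∧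
      (unary x).2.reverse = ((words (tokens y).reverse).flatMap fun h =>
        (words (tokens y).reverse).map fun w => (comparison h w).bit) ∧
      ∀ h ∈ words (tokens y).reverse, RowOk (words (tokens y).reverse) h := by
  rw [result]
  exact (tableRun_control _ _ _ _ _).trans (by simp)

/-! ### Certificates -/

theorem countP_ofFn {α : Type*} {n : ℕ} (f : Fin n → α) (p : α → Bool) :
    (List.ofFn f).countP p = (Finset.univ.filter fun i => p (f i) = true).card := by
  induction n with
  | zero => simp
  | succ n ih =>
    rw [List.ofFn_succ, List.countP_cons, Fin.card_filter_univ_succ, ih]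
    split_ifs <;> simp

/-- The table of words of a certificate. -/
structure IsTable {n : ℕ} (w : Fin n → List Tok) : Prop where
  length_eq : ∀ i j, (w i).length = (w j).length
  nonempty : ∀ i, ∃ t, track (w i) t = true
  conv : ∀ i a b c, a < b → b < c → track (w i) a = true → track (w i) c = true →
    track (w i) b = true
  identity : Function.Injective fun i => (w i).map fun s => s.2.2.2.2
  colour : ∀ i, (Finset.univ.filter fun j =>
    (w i).map (fun s => s.2.2.1) = (w j).map (fun s => s.2.2.1)).card ≤ 2
  target : ∀ i, ∃ a b, a ≠ b ∧ (w i).map (fun s => s.2.2.2.1) = (w a).map (fun s => s.2.2.1) ∧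
    (w i).map (fun s => s.2.2.2.1) = (w b).map (fun s => s.2.2.1) ∧
    (∃ t, track (w i) t = true ∧ track (w a) t = true) ∧
    ∃ t, track (w i) t = true ∧ track (w b) t = true

theorem rowOk_iff_isTable {n : ℕ} (w : Fin n → List Tok) :
    (∀ h ∈ List.ofFn w, RowOk (List.ofFn w) h) ↔ IsTable w := by
  simp only [RowOk, List.forall_mem_ofFn_iff, countP_ofFn, comparison_valid]
  constructor
  · intro h
    -- A single comparison only bounds the length of one word by the other; running over ordered
    -- pairs in both orders gives equality.
    have hl (i j) : (w i).length = (w j).length := ((h j).1 i).1.antisymm ((h i).1 j).1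
    refine ⟨hl, fun i => ((h i).1 i).2.1, fun i => ((h i).1 i).2.2, fun i j hij => ?_, fun i => ?_,
      fun i => ?_⟩
    · refine Finset.card_le_one.1 (h i).2.1.le i ?_ j ?_ <;>
        simp_all [comparison_eqI (hl _ i)]
    · simpa [comparison_eqC (hl _ i)] using (h i).2.2.1
    · obtain ⟨a, ha, b, hb, hab⟩ := Finset.one_lt_card.1 (h i).2.2.2
      simp only [Finset.mem_filter, Finset.mem_univ, true_and, Bool.and_eq_true, comparison_ov,
        comparison_eqT (hl _ i)] at ha hb
      exact ⟨a, b, hab, ha.1, hb.1, ha.2, hb.2⟩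
  · intro h i
    refine ⟨fun j => ⟨(h.length_eq j i).le, h.nonempty j, h.conv j⟩, ?_, ?_, ?_⟩
    · rw [Finset.card_eq_one]
      refine ⟨i, Finset.ext fun j => ?_⟩
      simp only [Finset.mem_filter, Finset.mem_univ, true_and, comparison_eqI (h.length_eq j i),
        Finset.mem_singleton]
      exact ⟨fun e => (h.identity e).symm, fun e => e ▸ rfl⟩
    · simpa [comparison_eqC (h.length_eq _ i)] using h.colour i
    · obtain ⟨a, b, hab, h1, h2, h3, h4⟩ := h.target i
      refine Finset.one_lt_card.2 ⟨a, ?_, b, ?_, hab⟩ <;>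
        simp only [Finset.mem_filter, Finset.mem_univ, true_and, Bool.and_eq_true, comparison_ov,
          comparison_eqT (h.length_eq _ i)]
      exacts [⟨h1, h3⟩, ⟨h2, h4⟩]

theorem IsTable.bit_iff {n : ℕ} {w : Fin n → List Tok} (h : IsTable w) (i j : Fin n) :
    (comparison (w i) (w j)).bit = true ↔
      i ≠ j ∧ ∃ t, track (w i) t = true ∧ track (w j) t = true := by
  rw [Cell.bit, Bool.and_eq_true, comparison_ov, and_comm, Bool.not_eq_true', ← Bool.not_eq_true,
    comparison_eqI (h.length_eq j i)]
  exact and_congr_left fun _ => h.identity.ne_iff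

/-- The graph of a table. -/
def tableGraph {n : ℕ} (w : Fin n → List Tok) : SimpleGraph (Fin n) where
  Adj i j := i ≠ j ∧ ∃ t, track (w i) t = true ∧ track (w j) t = true
  symm := ⟨fun _ _ h => ⟨h.1.symm, h.2.imp fun _ h => h.symm⟩⟩
  loopless := ⟨fun _ h => h.1 rfl⟩

theorem IsTable.isIntervalGraph {n : ℕ} {w : Fin n → List Tok} (h : IsTable w) :
    IsIntervalGraph (tableGraph w) := by
  choose l r hlr ht using fun i => exists_track_iff_le (h.nonempty i) (h.conv i)
  refine ⟨fun i => l i, fun i => r i, fun i => Nat.cast_le.2 (hlr i), fun i j hij => ?_⟩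
  simp only [tableGraph, ht, ne_eq, hij, not_false_eq_true, true_and, Set.Icc_inter_Icc,
    Set.nonempty_Icc]
  rw [← Nat.cast_max, ← Nat.cast_min, Nat.cast_le]
  have := hlr i
  have := hlr j
  exact ⟨fun ⟨t, h1, h2⟩ => by omega, fun h => ⟨max (l i) (l j), by omega⟩⟩

/-- Two distinct vertices are matched when their colours agree; classes of size at most two make
this a matching, and the target of `u` names a class lying in `N[u]`. -/
theorem IsTable.pairable {n : ℕ} {w : Fin n → List Tok} (h : IsTable w) :
    Pairable (fun x u => x ∈ closedNbhd (tableGraph w) u) Set.univ Set.univ := by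
  refine ⟨fun a b => a ≠ b ∧ (w a).map (fun s => s.2.2.1) = (w b).map (fun s => s.2.2.1),
    fun a b hab => ⟨hab.1.symm, hab.2.symm⟩, fun a ha => ha.1 rfl, fun a b c hab hac => ?_,
    fun _ _ _ => trivial, fun u _ => ?_⟩
  · by_contra hbc
    have := (Finset.card_le_card (s := {a, b, c}) fun x hx => ?_).trans (h.colour a)
    · rw [Finset.card_eq_three.2 ⟨a, b, c, hab.1, hac.1, hbc, rfl⟩] at this
      omega
    · simp only [Finset.mem_insert, Finset.mem_singleton] at hx
      simp only [Finset.mem_filter, Finset.mem_univ, true_and]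
      rcases hx with rfl | rfl | rfl
      exacts [rfl, hab.2, hac.2]
  · obtain ⟨a, b, hab, h1, h2, h3, h4⟩ := h.target u
    refine ⟨a, b, ⟨hab, h1.symm.trans h2⟩, ?_, ?_⟩
    · exact or_iff_not_imp_left.2 fun hu => ⟨fun e => hu e.symm, h3⟩
    · exact or_iff_not_imp_left.2 fun hu => ⟨fun e => hu e.symm, h4⟩

/-! #### The table of a graph -/

theorem track_ofFn {n : ℕ} (f : Fin n → Tok) (t : ℕ) :
    track (List.ofFn f) t = true ↔ ∃ h : t < n, (f ⟨t, h⟩).2.1 = true := by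
  by_cases h : t < n
  · simp [track, h]
  · simp only [track, List.getD_eq_getElem?_getD, h, IsEmpty.exists_iff, iff_false]
    rw [List.getElem?_eq_none (by simpa using h)]
    decide

open Classical in
/-- The word of the vertex `i` of an interval graph with intervals `[l i, r i]`, where `p` sorts the
right ends, `col` gives the pairs and `tgt i` is the colour of a pair in `N[i]`. -/
noncomputable def graphWord {n : ℕ} (l r : Fin n → ℝ) (p : Fin n → Fin n) (col tgt : Fin n → Fin n)
    (i : Fin n) : List Tok :=
  List.ofFn fun t => (decide (t.val + 1 = n), decide (l i ≤ r (p t) ∧ r (p t) ≤ r i),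
    decide (t = col i), decide (t = tgt i), decide (t = i))

theorem ofFn_decide_eq_iff {n : ℕ} {a b : Fin n} :
    (List.ofFn fun t => decide (t = a)) = (List.ofFn fun t => decide (t = b)) ↔ a = b := by
  rw [List.ofFn_injective.eq_iff]
  refine ⟨fun h => ?_, fun h => h ▸ rfl⟩
  simpa using congrFun h a

/-- Intervals are recorded by the right ends they contain, in sorted order, which makes each track a
contiguous block. Nothing is lost: two intersecting intervals share the smaller of their right ends.
-/
theorem exists_table {n : ℕ} {G : SimpleGraph (Fin n)} {l r : Fin n → ℝ} (hlr : ∀ v, l v ≤ r v)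
    (hG : ∀ v w, v ≠ w → (G.Adj v w ↔ (Set.Icc (l v) (r v) ∩ Set.Icc (l w) (r w)).Nonempty))
    {R : Fin n → Fin n → Prop}
    (hR : IsPairing (fun x u => x ∈ closedNbhd G u) Set.univ Set.univ R) :
    ∃ p col tgt, IsTable (graphWord l r p col tgt) ∧ tableGraph (graphWord l r p col tgt) = G := by
  classical
  set p := Tuple.sort r with hp
  have hmono : Monotone (r ∘ p) := Tuple.monotone_sort r
  -- The matching is extended to an involution fixing unmatched vertices, so that `min i (par i)` is
  -- a colour shared exactly by partners.
  obtain ⟨par, hpar, hinv⟩ : ∃ par : Fin n → Fin n, (∀ {i j}, R i j → par i = j) ∧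
      ∀ i, par (par i) = i := by
    let par : Fin n → Fin n := fun i => if h : ∃ j, R i j then h.choose else i
    have hpar {i j} (h : R i j) : par i = j := by
      have hex : ∃ j, R i j := ⟨j, h⟩
      simp only [par, dif_pos hex]
      exact hR.unique _ _ _ hex.choose_spec h
    refine ⟨par, hpar, fun i => ?_⟩
    by_cases hex : ∃ j, R i j
    · obtain ⟨j, hj⟩ := hex
      rw [hpar hj, hpar (hR.symm _ _ hj)]
    · simp only [par, dif_neg hex]
  let col : Fin n → Fin n := fun i => min i (par i)
  have hcol {i j} (h : R i j) : col i = col j := by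
    simp only [col, hpar h, hpar (hR.symm _ _ h), min_comm]
  have hcol' {i j} (h : col i = col j) : j = i ∨ j = par i := by
    simp only [col] at h
    rcases min_choice i (par i) with e | e <;> rcases min_choice j (par j) with e' | e' <;>
      rw [e, e'] at h
    · exact Or.inl h.symm
    · exact Or.inr (by rw [h, hinv])
    · exact Or.inr h.symm
    · exact Or.inl (by rw [← hinv i, h, hinv])
  choose a b hab ha hb using fun u => hR.cover u trivial
  have htrack (i : Fin n) (t : ℕ) : track (graphWord l r p col (col ∘ a) i) t = true ↔
      ∃ h : t < n, l i ≤ r (p ⟨t, h⟩) ∧ r (p ⟨t, h⟩) ≤ r i := by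
    simp [graphWord, track_ofFn]
  have hov (i j : Fin n) : (∃ t, track (graphWord l r p col (col ∘ a) i) t = true ∧
      track (graphWord l r p col (col ∘ a) j) t = true) ↔
      (Set.Icc (l i) (r i) ∩ Set.Icc (l j) (r j)).Nonempty := by
    simp only [htrack]
    constructor
    · rintro ⟨t, ⟨h, h1⟩, _, h2⟩
      exact ⟨_, h1, h2⟩
    · rintro ⟨x, h1, h2⟩
      rcases le_total (r i) (r j) with h | h
      · refine ⟨p.symm i, ⟨Fin.is_lt _, ?_⟩, Fin.is_lt _, ?_⟩ <;>
          simp only [Fin.eta, Equiv.apply_symm_apply]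
        exacts [⟨hlr i, le_rfl⟩, ⟨h2.1.trans h1.2, h⟩]
      · refine ⟨p.symm j, ⟨Fin.is_lt _, ?_⟩, Fin.is_lt _, ?_⟩ <;>
          simp only [Fin.eta, Equiv.apply_symm_apply]
        exacts [⟨h1.1.trans h2.2, h⟩, ⟨hlr j, le_rfl⟩]
  have hov' {i j : Fin n} (h : j ∈ closedNbhd G i) :
      ∃ t, track (graphWord l r p col (col ∘ a) i) t = true ∧
        track (graphWord l r p col (col ∘ a) j) t = true := by
    rw [hov]
    rcases eq_or_ne i j with rfl | hij
    · exact ⟨l i, ⟨le_rfl, hlr i⟩, le_rfl, hlr i⟩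
    · exact (hG i j hij).1 (h.resolve_left hij.symm)
  have hC (i) : (graphWord l r p col (col ∘ a) i).map (fun s => s.2.2.1) =
      List.ofFn fun t => decide (t = col i) := by simp [graphWord, List.map_ofFn, Function.comp_def]
  have hT (i) : (graphWord l r p col (col ∘ a) i).map (fun s => s.2.2.2.1) =
      List.ofFn fun t => decide (t = col (a i)) := by
    simp [graphWord, List.map_ofFn, Function.comp_def]
  have hI (i) : (graphWord l r p col (col ∘ a) i).map (fun s => s.2.2.2.2) =
      List.ofFn fun t => decide (t = i) := by simp [graphWord, List.map_ofFn, Function.comp_def]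
  refine ⟨p, col, col ∘ a, ⟨fun i j => by simp [graphWord], fun i => ?_, fun i x y z hxy hyz => ?_,
    fun i j hij => ?_, fun i => ?_, fun i => ?_⟩, ?_⟩
  · obtain ⟨t, ht, -⟩ := (hov i i).2 ⟨l i, ⟨le_rfl, hlr i⟩, le_rfl, hlr i⟩
    exact ⟨t, ht⟩
  · simp only [htrack]
    rintro ⟨hx, h1, -⟩ ⟨hz, -, h2⟩
    refine ⟨hyz.trans hz, h1.trans (hmono (a := ⟨x, hx⟩) ?_), (hmono (b := ⟨z, hz⟩) ?_).trans h2⟩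
    exacts [hxy.le, hyz.le]
  · simpa only [hI, ofFn_decide_eq_iff] using hij
  · simp only [hC, ofFn_decide_eq_iff]
    refine (Finset.card_le_card (t := {i, par i}) fun j hj => ?_).trans Finset.card_le_two
    simpa using hcol' (Finset.mem_filter.1 hj).2
  · refine ⟨a i, b i, fun e => hR.irrefl (b i) (by simpa only [e] using hab i), ?_, ?_,
      hov' (ha i), hov' (hb i)⟩
    · rw [hT, hC]
    · rw [hT, hC, hcol (hab i)]
  · ext i j
    simp only [tableGraph, hov]
    exact ⟨fun h => (hG i j h.1).2 h.2, fun h => ⟨h.ne, (hG i j h.ne).1 h⟩⟩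

/-! #### Encodings -/

theorem words_flatten (W : List (List Tok))
    (h : ∀ w ∈ W, ∃ v t, w = v ++ [t] ∧ (∀ s ∈ v, s.1 = false) ∧ t.1 = true) :
    words W.flatten = W := by
  induction W with
  | nil => rfl
  | cons w W ih =>
    obtain ⟨v, t, rfl, hv, ht⟩ := h w (by simp)
    have ih := ih fun w hw => h w (by simp [hw])
    rw [List.flatten_cons]
    clear h
    induction v with
    | nil => simp [words, ht, ih]
    | cons s v ihv =>
      have hs := hv s (by simp)
      have := ihv fun s hs => hv s (by simp [hs])
      rw [List.cons_append, List.cons_append, words, if_neg (by simp [hs]), this]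

/-- The bits of a token. -/
def tokenBits (t : Tok) : List Bool := [t.1, t.2.1, t.2.2.1, t.2.2.2.1, t.2.2.2.2]

theorem tokens_flatMap (l : List Tok) : tokens (l.flatMap tokenBits) = l := by
  induction l with
  | nil => simp [tokens]
  | cons t l ih => simp [tokenBits, tokens] at ih ⊢; exact ih

theorem unary_replicate (n : ℕ) (x : List Bool) :
    unary (List.replicate n true ++ false :: x) = (n, x) := by
  induction n with
  | zero => rfl
  | succ n ih => simp [List.replicate_succ, unary, ih]

/-- A word without a `0` parses to a positive size with an empty matrix, which no table can match.
-/
theorem eq_replicate_unary (x : List Bool) :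
    x = List.replicate (unary x).1 true ++ false :: (unary x).2 ∨
      (unary x).1 ≠ 0 ∧ (unary x).2 = [] := by
  induction x with
  | nil => simp [unary]
  | cons b x ih =>
    cases b
    · simp [unary]
    · rcases ih with ih | ih
      · left
        simp only [unary, List.replicate_succ, List.cons_append]
        rw [← ih]
      · exact Or.inr ⟨by simp [unary], by simp [unary, ih]⟩

theorem result_control_iff {n : ℕ} (w : Fin n → List Tok) (x y : List Bool)
    (hw : words (tokens y).reverse = (List.ofFn w).reverse) :
    result control (x, y) = true ↔ IsTable w ∧ x = encodeGraph (tableGraph w) := by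
  have hbits (h : IsTable w) : ((List.finRange n).flatMap fun i => (List.finRange n).map fun j =>
      (comparison (w i) (w j)).bit) = (List.finRange n).flatMap fun i =>
      (List.finRange n).map fun j => @decide ((tableGraph w).Adj i j) (Classical.propDecidable _) := by
    congr 1
    funext i
    congr 1
    funext j
    rw [Bool.eq_iff_iff, h.bit_iff, @decide_eq_true_iff _ (Classical.propDecidable _)]
    rfl
  -- Pushing onto stacks reverses the matrix bits and the list of words alike; reversing the order
  -- of both rows and columns reverses the row-major matrix, so the entries still correspond.
  have hrev : (((List.ofFn w).reverse.flatMap fun h => (List.ofFn w).reverse.map fun v =>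
      (comparison h v).bit)).reverse = (List.finRange n).flatMap fun i =>
        (List.finRange n).map fun j => (comparison (w i) (w j)).bit := by
    rw [List.reverse_flatMap]
    simp [List.ofFn_eq_map, List.flatMap_map, Function.comp_def]
  have hrow (h : List Tok) : RowOk (List.ofFn w).reverse h ↔ RowOk (List.ofFn w) h := by
    simp [RowOk]
  rw [result_control, hw]
  simp only [List.mem_reverse, hrow, rowOk_iff_isTable, List.length_reverse, List.length_ofFn]
  rw [← List.reverse_eq_iff.symm, hrev]
  constructor
  · rintro ⟨h1, h2, h3⟩
    refine ⟨h3, ?_⟩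
    rw [hbits h3] at h2
    rcases eq_replicate_unary x with hx | ⟨hx, hx'⟩
    · rw [hx, h1, h2, encodeGraph]
    · rw [hx'] at h2
      have := congrArg List.length h2
      simp [List.length_flatMap] at this
      omega
  · rintro ⟨h, rfl⟩
    rw [encodeGraph, unary_replicate, hbits h]
    exact ⟨rfl, rfl, h⟩

theorem graphWord_eq_append {n : ℕ} (l r : Fin n → ℝ) (p col tgt : Fin n → Fin n) (i : Fin n) :
    ∃ v t, graphWord l r p col tgt i = v ++ [t] ∧ (∀ s ∈ v, s.1 = false) ∧ t.1 = true := by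
  obtain _ | n := n
  · exact i.elim0
  · rw [graphWord, List.ofFn_succ', List.concat_eq_append]
    refine ⟨_, _, rfl, ?_, by simp⟩
    simp only [List.forall_mem_ofFn_iff]
    intro j
    simpa using j.is_lt.ne

end TableMachine

open TableMachine

theorem inNP_outcomeDIntervalGraphs : InNP outcomeDIntervalGraphs := by
  refine ⟨5 * Polynomial.X, result control, ?_, fun x => ⟨?_, ?_⟩⟩
  · have := Fintype.ofFinite State
    exact nonempty_polyTime control
  · rintro ⟨n, G, hG, hD, rfl⟩
    obtain ⟨R, hR⟩ := hG.hasOutcomeD_iff_pairable.1 hD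
    obtain ⟨l, r, hlr, hadj⟩ := hG
    obtain ⟨p, col, tgt, ht, hGr⟩ := exists_table hlr hadj hR
    set w := graphWord l r p col tgt with hw
    -- The outer reversal undoes the one caused by the token stacks, so that end flags again close
    -- their words. There are `n * n` tokens of five bits, and the encoded graph already has `n * n`
    -- matrix bits, whence the bound `5 * X`.
    refine ⟨(List.ofFn w).reverse.flatten.reverse.flatMap tokenBits, ?_, ?_⟩
    · have h1 (L : List Tok) : (L.flatMap tokenBits).length = 5 * L.length := by
        simp [List.length_flatMap, tokenBits, mul_comm]
      have h2 : (List.ofFn w).reverse.flatten.length = n * n := by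
        simp [List.length_flatten, List.map_ofFn, Function.comp_def, hw, graphWord]
      rw [h1, List.length_reverse, h2]
      simp [encodeGraph, List.length_flatMap]
      omega
    · rw [result_control_iff w, hGr]
      · exact ⟨ht, rfl⟩
      · rw [tokens_flatMap, List.reverse_reverse, words_flatten]
        simp only [List.mem_reverse, List.forall_mem_ofFn_iff]
        exact graphWord_eq_append l r p col tgt
  · rintro ⟨y, -, hy⟩
    -- Every certificate is read as a table of some number of words; acceptance alone forces the
    -- input to encode the graph of that table.
    have hw : words (tokens y).reverse =
        (List.ofFn (words (tokens y).reverse).reverse.get).reverse := by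
      rw [List.ofFn_get, List.reverse_reverse]
    obtain ⟨ht, hx⟩ := (result_control_iff _ x y hw).1 hy
    exact ⟨_, _, ht.isIntervalGraph, ht.isIntervalGraph.hasOutcomeD_iff_pairable.2 ht.pairable, hx⟩

end MBDomination

theorem mainTheorem7 :
    MBDomination.InNP MBDomination.outcomeDIntervalGraphs ∧
    ∀ (V : Type*) [Finite V] (G : SimpleGraph V), MBDomination.IsIntervalGraph G →
      (MBDomination.HasOutcomeD G ↔
        ∃ (k : ℕ) (u v : Fin k → V), MBDomination.IsPairingDominatingSet G u v) :=
  ⟨MBDomination.inNP_outcomeDIntervalGraphs, fun _ _ G hG =>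
    hG.hasOutcomeD_iff_pairable.trans
      (MBDomination.pairable_iff_exists_isPairingDominatingSet G)⟩
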